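/- Let $\mathsf{N_C}$ and $\mathsf{N_R}$ be disjoint countably infinite sets of concept names and role names. $\mathcal{ALC}$ concepts are given by $C,D ::= \top \mid A \mid \neg C \mid C\sqcap D \mid \exists r.C$ with $A\in\mathsf{N_C}$, $r\in\mathsf{N_R}$, with the usual semantics in interpretations with non-empty domain. An $\mathcal{ALCH}$ ontology is a finite set $\mathcal{O}$ of concept inclusions $C\sqsubseteq D$ between $\mathcal{ALC}$ concepts and of role inclusions $r\sqsubseteq s$ between role names; $\mathcal{O}\models C\sqsubseteq D$ means that $C^{\mathcal I}\subseteq D^{\mathcal I}$ in every model $\mathcal I$ of $\mathcal O$. A signature is a set $\Sigma$ of concept and role names, and an $\mathcal{ALC}(\Sigma)$ interpolant for $\mathcal O\models C_0\sqsubseteq D_0$ is an $\mathcal{ALC}$ concept $E$ that uses only names from $\Sigma$ and satisfies $\mathcal O\models C_0\sqsubseteq E$ and $\mathcal O\models E\sqsubseteq D_0$. The size $\|X\|$ of a syntactic object is the number of symbols needed to write it as a word over a finite alphabet, with names written as a letter followed by an index in binary. A DAG representation of a concept is a rooted directed acyclic graph whose nodes are labelled by constructors with pointers to the argument nodes, and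 which unfolds to the concept. Theorem. There are an algorithm and a polynomial $p$ such that the following holds for every $\mathcal{ALCH}$ ontology $\mathcal O$, all $\mathcal{ALC}$ concepts $C_0,D_0$ and every signature $\Sigma$. If there is an $\mathcal{ALC}(\Sigma)$ interpolant for $\mathcal O\models C_0\sqsubseteq D_0$, then the algorithm, given $\mathcal O,C_0,D_0$ as input and access to $\Sigma$ by tests whether a given name belongs to $\Sigma$, outputs a DAG representation of an $\mathcal{ALC}(\Sigma)$ interpolant for $\mathcal O\models C_0\sqsubseteq D_0$ in time at most $2^{2^{p(n)}}$, where $n=\|\mathcal O\|+\|C_0\|+\|D_0\|$. -/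

import Mathlib

namespace ALCH

/-! ### Syntax and semantics of ALC concepts and ALCH ontologies -/

/-- Concept names and role names are two separate countably infinite supplies. -/
abbrev ConceptName := ℕ

abbrev RoleName := ℕ

/-- ALC concepts `⊤ | A | ¬C | C ⊓ D | ∃r.C`; the other constructors are abbreviations. -/
inductive Concept : Type
  | top : Concept
  | atom : ConceptName → Concept
  | neg : Concept → Concept
  | inf : Concept → Concept → Concept
  | ex : RoleName → Concept → Concept

/-- The inclusions allowed in an ALCH ontology: `C ⊑ D` for ALC concepts, `r ⊑ s` for role names. -/
inductive Inclusion : Type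
  | concept : Concept → Concept → Inclusion
  | role : RoleName → RoleName → Inclusion

/-- An ALCH ontology, written down as a list of inclusions. -/
abbrev Ontology := List Inclusion

/-- A signature is an arbitrary (possibly infinite) set of concept and role names. -/
structure Signature where
  conceptNames : Set ConceptName
  roleNames : Set RoleName

/-- Interpretations with a non-empty domain. -/
structure Interpretation where
  Dom : Type
  nonempty : Nonempty Dom
  concept : ConceptName → Set Dom
  role : RoleName → Set (Dom × Dom)

/-- The extension of a concept in an interpretation. -/
def Concept.ext (I : Interpretation) : Concept → Set I.Dom
  | .top => Set.univ
  | .atom A => I.concept A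
  | .neg C => (C.ext I)ᶜ
  | .inf C D => C.ext I ∩ D.ext I
  | .ex r C => {d | ∃ e, (d, e) ∈ I.role r ∧ e ∈ C.ext I}

def Interpretation.Satisfies (I : Interpretation) : Inclusion → Prop
  | .concept C D => C.ext I ⊆ D.ext I
  | .role r s => I.role r ⊆ I.role s

def Interpretation.IsModel (I : Interpretation) (O : Ontology) : Prop :=
  ∀ α ∈ O, I.Satisfies α

/-- `O ⊨ C ⊑ D`. -/
def Subsumes (O : Ontology) (C D : Concept) : Prop :=
  ∀ I : Interpretation, I.IsModel O → C.ext I ⊆ D.ext I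

/-- `C` is an `ALC(S)` concept: it uses only names from `S`. -/
def Concept.Over (S : Signature) : Concept → Prop
  | .top => True
  | .atom A => A ∈ S.conceptNames
  | .neg C => C.Over S
  | .inf C D => C.Over S ∧ D.Over S
  | .ex r C => r ∈ S.roleNames ∧ C.Over S

/-- `E` is an `ALC(S)` interpolant for `O ⊨ C ⊑ D`. -/
def IsInterpolant (O : Ontology) (S : Signature) (C D E : Concept) : Prop :=
  E.Over S ∧ Subsumes O C E ∧ Subsumes O E D

/-! ### Size: the number of symbols of a word over a finite alphabet.
A name is one letter followed by its index in binary. -/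

def nameSize (n : ℕ) : ℕ := 1 + n.size

def Concept.size : Concept → ℕ
  | .top => 1
  | .atom A => nameSize A
  | .neg C => 1 + C.size
  | .inf C D => 1 + C.size + D.size
  | .ex r C => 1 + nameSize r + C.size

def Inclusion.size : Inclusion → ℕ
  | .concept C D => 1 + C.size + D.size
  | .role r s => 1 + nameSize r + nameSize s

def Ontology.size (O : Ontology) : ℕ := (O.map Inclusion.size).sum

/-! ### DAG representations of concepts -/

/-- A node of a DAG: a constructor whose argument concepts are pointers to other nodes. -/
inductive Node : Type
  | top : Node
  | atom : ConceptName → Node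
  | neg : ℕ → Node
  | inf : ℕ → ℕ → Node
  | ex : RoleName → ℕ → Node

/-- The pointers of a node. -/
def Node.children : Node → List ℕ
  | .top => []
  | .atom _ => []
  | .neg i => [i]
  | .inf i j => [i, j]
  | .ex _ i => [i]

/-- A rooted DAG, given by its nodes in topological order: pointers refer to earlier nodes. -/
structure DAG where
  nodes : List Node
  root : ℕ
  root_lt : root < nodes.length
  children_lt : ∀ (i : ℕ) (v : Node), nodes[i]? = some v → ∀ j ∈ v.children, j < i

/-- `Unfolds l i C`: unfolding node number `i` of `l` gives the concept `C`. -/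
inductive Unfolds (l : List Node) : ℕ → Concept → Prop
  | top {i : ℕ} : l[i]? = some Node.top → Unfolds l i Concept.top
  | atom {i : ℕ} {A : ConceptName} :
      l[i]? = some (Node.atom A) → Unfolds l i (Concept.atom A)
  | neg {i j : ℕ} {C : Concept} :
      l[i]? = some (Node.neg j) → Unfolds l j C → Unfolds l i (Concept.neg C)
  | inf {i j k : ℕ} {C D : Concept} :
      l[i]? = some (Node.inf j k) → Unfolds l j C → Unfolds l k D →
        Unfolds l i (Concept.inf C D)
  | ex {i j : ℕ} {r : RoleName} {C : Concept} :
      l[i]? = some (Node.ex r j) → Unfolds l j C → Unfolds l i (Concept.ex r C)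

/-- `G` is a DAG representation of the concept `C`. -/
def DAG.Represents (G : DAG) (C : Concept) : Prop := Unfolds G.nodes G.root C

/-! ### The machine model: WHILE programs on binary trees, with an oracle.

Variables hold finite binary trees. Every evaluation of a (sub)expression is charged the number of
nodes of the tree it yields, so no tree is copied, compared or queried for free, and running times
agree with those of multitape Turing machines up to a polynomial. -/

inductive Data : Type
  | nil : Data
  | cons : Data → Data → Data

def Data.size : Data → ℕ
  | .nil => 1
  | .cons a b => 1 + a.size + b.size

def Data.hd : Data → Data
  | .nil => .nil
  | .cons a _ => a

def Data.tl : Data → Data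
  | .nil => .nil
  | .cons _ b => b

/-- Truth values: false is `nil`, true is `cons nil nil`. -/
noncomputable def Data.ofProp (p : Prop) : Data :=
  open Classical in if p then .cons .nil .nil else .nil

inductive Expr : Type
  | var : ℕ → Expr
  | nil : Expr
  | cons : Expr → Expr → Expr
  | hd : Expr → Expr
  | tl : Expr → Expr
  | eq : Expr → Expr → Expr
  | query : Expr → Expr

abbrev Store := ℕ → Data

/-- Value of an expression, where `A` is the oracle. -/
noncomputable def Expr.eval (A : Set Data) (σ : Store) : Expr → Data
  | .var x => σ x
  | .nil => .nil
  | .cons e f => .cons (e.eval A σ) (f.eval A σ)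
  | .hd e => (e.eval A σ).hd
  | .tl e => (e.eval A σ).tl
  | .eq e f => Data.ofProp (e.eval A σ = f.eval A σ)
  | .query e => Data.ofProp (e.eval A σ ∈ A)

/-- Cost of an expression: the sum of the sizes of the values of all its subexpressions. -/
noncomputable def Expr.cost (A : Set Data) (σ : Store) : Expr → ℕ
  | .var x => (σ x).size
  | .nil => 1
  | .cons e f => e.cost A σ + f.cost A σ + ((Expr.cons e f).eval A σ).size
  | .hd e => e.cost A σ + ((Expr.hd e).eval A σ).size
  | .tl e => e.cost A σ + ((Expr.tl e).eval A σ).size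
  | .eq e f => e.cost A σ + f.cost A σ + ((Expr.eq e f).eval A σ).size
  | .query e => e.cost A σ + ((Expr.query e).eval A σ).size

inductive Program : Type
  | assign : ℕ → Expr → Program
  | seq : Program → Program → Program
  | ite : Expr → Program → Program → Program
  | loop : Expr → Program → Program

/-- `Exec A P σ τ t`: with oracle `A`, started in the store `σ`, the program `P` halts in the
store `τ` after time `t`. -/
inductive Exec (A : Set Data) : Program → Store → Store → ℕ → Prop
  | assign (x : ℕ) (e : Expr) (σ : Store) :
      Exec A (.assign x e) σ (Function.update σ x (e.eval A σ)) (e.cost A σ + 1)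
  | seq {P Q : Program} {σ τ υ : Store} {t u : ℕ} :
      Exec A P σ τ t → Exec A Q τ υ u → Exec A (.seq P Q) σ υ (t + u + 1)
  | ite_true {e : Expr} {P Q : Program} {σ τ : Store} {t : ℕ} :
      e.eval A σ ≠ .nil → Exec A P σ τ t → Exec A (.ite e P Q) σ τ (e.cost A σ + t + 1)
  | ite_false {e : Expr} {P Q : Program} {σ τ : Store} {t : ℕ} :
      e.eval A σ = .nil → Exec A Q σ τ t → Exec A (.ite e P Q) σ τ (e.cost A σ + t + 1)
  | loop_done {e : Expr} {P : Program} {σ : Store} :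
      e.eval A σ = .nil → Exec A (.loop e P) σ σ (e.cost A σ + 1)
  | loop_step {e : Expr} {P : Program} {σ τ υ : Store} {t u : ℕ} :
      e.eval A σ ≠ .nil → Exec A P σ τ t → Exec A (.loop e P) τ υ u →
        Exec A (.loop e P) σ υ (e.cost A σ + t + u + 1)

/-- The input is in variable `0` and all other variables are `nil`. -/
def initStore (a : Data) : Store := fun x => if x = 0 then a else .nil

/-- With oracle `A`, on input `a`, the program `P` halts with output `b` (in variable `0`) after
time `t`. -/
def Program.OutputsIn (P : Program) (A : Set Data) (a b : Data) (t : ℕ) : Prop :=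
  ∃ τ : Store, Exec A P (initStore a) τ t ∧ τ 0 = b

/-! ### Encoding of inputs and outputs as trees -/

def encList : List Data → Data
  | [] => .nil
  | a :: l => .cons a (encList l)

/-- Unary numerals, used for constructor tags and for the pointers of DAGs. -/
def encUnary (n : ℕ) : Data := encList (List.replicate n .nil)

def encBit : Bool → Data
  | false => .nil
  | true => .cons .nil .nil

/-- Names are given by their index in binary, least significant bit first. -/
def encName (n : ℕ) : Data := encList (n.bits.map encBit)

def Concept.encode : Concept → Data
  | .top => .cons (encUnary 0) .nil
  | .atom A => .cons (encUnary 1) (encName A)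
  | .neg C => .cons (encUnary 2) C.encode
  | .inf C D => .cons (encUnary 3) (.cons C.encode D.encode)
  | .ex r C => .cons (encUnary 4) (.cons (encName r) C.encode)

def Inclusion.encode : Inclusion → Data
  | .concept C D => .cons (encUnary 0) (.cons C.encode D.encode)
  | .role r s => .cons (encUnary 1) (.cons (encName r) (encName s))

def encInput (O : Ontology) (C D : Concept) : Data :=
  .cons (encList (O.map Inclusion.encode)) (.cons C.encode D.encode)

def Node.encode : Node → Data
  | .top => .cons (encUnary 0) .nil
  | .atom A => .cons (encUnary 1) (encName A)
  | .neg i => .cons (encUnary 2) (encUnary i)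
  | .inf i j => .cons (encUnary 3) (.cons (encUnary i) (encUnary j))
  | .ex r i => .cons (encUnary 4) (.cons (encName r) (encUnary i))

def DAG.encode (G : DAG) : Data :=
  .cons (encUnary G.root) (encList (G.nodes.map Node.encode))

/-- The oracle through which a program accesses a signature: it answers whether a given concept
name, or a given role name, belongs to the signature. Since a signature may be infinite and its
size does not enter the time bound, it is not part of the written input. -/
def Signature.oracle (S : Signature) : Set Data :=
  {a | (∃ A ∈ S.conceptNames, a = .cons (encUnary 0) (encName A)) ∨
    ∃ r ∈ S.roleNames, a = .cons (encUnary 1) (encName r)}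

end ALCH

namespace ALCH

open scoped Classical

/-! ### Trees as lists -/

/-! A type is a set of subtrees of the input that respects the Boolean constructors and the concept
inclusions and belongs to a family of such sets that supplies witnesses for all its existential
restrictions. A mosaic is a set of types, thought of as realised by elements that agree on all
concepts over the signature. The statement `theta n t d` says that looking `n` steps along signature
roles from `d` does not rule out type `t`: atoms of the signature agree, every existential demand of
`t` has a mosaic with a witness, realised to depth `n - 1` along all signature roles above the
demanded one, and every signature successor offers a type compatible with `t`. This is expressible
by a concept over the signature. With `N` the number of mosaics, the candidate interpolant is the
disjunction of `theta N t` over the types `t` containing the left concept; its definition uses no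
given interpolant.

The left concept entails the candidate, since the true type of an element is possible at every depth
(`theta_of_represents`). Conversely, let `d` satisfy the candidate through `t`, and let `u` be the
true type of `d`. The mosaic `T` of all types possible at `d` to depth `N` contains `t` and `u` and
survives `N` rounds of elimination (`survives_of_exactly`), after which elimination is stable
(`survives_stable`). The pairs of a surviving mosaic and a type in it form a model of the ontology
(`mem_ext_mosaicModel`, `isModel_mosaicModel`), where pairs with the same mosaic satisfy the same
concepts over the signature (`mem_ext_mosaicModel_of_fst_eq`). Any interpolant thus holds at `(T,
t)`, hence at `(T, u)`, so `u` contains the right concept and `d` satisfies it.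

For the running time, types are sublists of the list of subtrees and mosaics are sublists of the
list of types. These two uses of `Data.subs` cost one exponential each; all else is polynomial in
the lists at hand. The DAG stays small because each `theta k t` is a single shared node, to which
the terms of depth `k + 1` refer by a placeholder. -/

theorem Data.size_pos (a : Data) : 1 ≤ a.size := by
  cases a <;> simp [Data.size]; omega

theorem Data.size_hd_le (a : Data) : a.hd.size ≤ a.size := by
  cases a <;> simp [Data.size, Data.hd]; omega

theorem Data.size_tl_le (a : Data) : a.tl.size ≤ a.size := by
  cases a <;> simp [Data.size, Data.tl]

theorem Data.size_ofProp_le (p : Prop) : (Data.ofProp p).size ≤ 3 := by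
  unfold Data.ofProp; split <;> simp [Data.size]

@[simp] theorem Data.ofProp_eq_nil (p : Prop) : Data.ofProp p = .nil ↔ ¬ p := by
  unfold Data.ofProp; split <;> simp_all

@[simp] theorem Data.hd_cons (a b : Data) : (Data.cons a b).hd = a := rfl
@[simp] theorem Data.tl_cons (a b : Data) : (Data.cons a b).tl = b := rfl
@[simp] theorem Data.hd_nil : Data.nil.hd = .nil := rfl
@[simp] theorem Data.tl_nil : Data.nil.tl = .nil := rfl

/-- Every tree is the list of the left subtrees along its right spine. -/
def Data.toList : Data → List Data
  | .nil => []
  | .cons a b => a :: b.toList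

@[simp] theorem Data.toList_nil : Data.nil.toList = [] := rfl
@[simp] theorem Data.toList_cons (a b : Data) : (Data.cons a b).toList = a :: b.toList := rfl

@[simp] theorem encList_toList (a : Data) : encList a.toList = a := by
  induction a with
  | nil => rfl
  | cons a b _ ih => simp [encList, ih]

@[simp] theorem toList_encList (l : List Data) : (encList l).toList = l := by
  induction l with
  | nil => rfl
  | cons a l ih => simp [encList, ih]

theorem Data.toList_eq_nil {a : Data} : a.toList = [] ↔ a = .nil := by
  cases a <;> simp

theorem size_encList (l : List Data) : (encList l).size = 1 + (l.map fun a => 1 + a.size).sum := by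
  induction l with
  | nil => rfl
  | cons a l ih => simp [encList, Data.size, ih]; omega

theorem Data.size_eq_sum (a : Data) : a.size = 1 + (a.toList.map fun a => 1 + a.size).sum := by
  rw [← size_encList, encList_toList]

theorem Data.length_toList_lt (a : Data) : a.toList.length < a.size := by
  induction a with
  | nil => simp [Data.size]
  | cons a b _ ih => simp [Data.size]; omega

theorem Data.size_lt_of_mem {a x : Data} (h : x ∈ a.toList) : x.size < a.size := by
  induction a with
  | nil => simp at h
  | cons a b _ ih =>
    simp only [toList_cons, List.mem_cons] at h
    rcases h with rfl | h
    · simp [Data.size]; omega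
    · have := ih h; simp [Data.size]; omega

/-! ### Polynomial bounds -/

theorem polynomial_eval_mono (q : Polynomial ℕ) {m n : ℕ} (h : m ≤ n) : q.eval m ≤ q.eval n := by
  rw [Polynomial.eval_eq_sum_range, Polynomial.eval_eq_sum_range]
  exact Finset.sum_le_sum fun i _ => Nat.mul_le_mul_left _ (Nat.pow_le_pow_left h i)

/-! ### Functions computed by programs -/

/-- `F` is computed in place, with time and result size bounded by `B` of the input size, by a
family of programs that work on the variables from a given number on. -/
def RunsIn (F : Set Data → Data → Data) (B : ℕ → ℕ) : Prop :=
  ∃ P : ℕ → Program, ∀ (A : Set Data) (b : ℕ) (σ : Store), ∃ (τ : Store) (t : ℕ),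
    Exec A (P b) σ τ t ∧ τ b = F A (σ b) ∧ (∀ x < b, τ x = σ x) ∧
      t ≤ B (σ b).size ∧ (F A (σ b)).size ≤ B (σ b).size

theorem RunsIn.mono {F : Set Data → Data → Data} {B B' : ℕ → ℕ} (h : RunsIn F B)
    (hB : ∀ n, B n ≤ B' n) : RunsIn F B' := by
  obtain ⟨P, hP⟩ := h
  refine ⟨P, fun A b σ => ?_⟩
  obtain ⟨τ, t, h1, h2, h3, h4, h5⟩ := hP A b σ
  exact ⟨τ, t, h1, h2, h3, h4.trans (hB _), h5.trans (hB _)⟩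

theorem RunsIn.comp {F G : Set Data → Data → Data} {B B' : ℕ → ℕ} (hF : RunsIn F B)
    (hG : RunsIn G B') (hB : Monotone B) :
    RunsIn (fun A x => F A (G A x)) (fun n => B (B' n) + B' n + 1) := by
  obtain ⟨P, hP⟩ := hF
  obtain ⟨Q, hQ⟩ := hG
  refine ⟨fun b => .seq (Q b) (P b), fun A b σ => ?_⟩
  obtain ⟨τ, t, h1, h2, h3, h4, h5⟩ := hQ A b σ
  obtain ⟨υ, u, k1, k2, k3, k4, k5⟩ := hP A b τ
  rw [h2] at k2 k4 k5
  have := hB h5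
  exact ⟨υ, _, .seq h1 k1, k2, fun x hx => (k3 x hx).trans (h3 x hx), by dsimp only; omega,
    by dsimp only; omega⟩

theorem RunsIn.expr {F : Set Data → Data → Data} {B : ℕ → ℕ} (e : ℕ → Expr)
    (he : ∀ A b σ, (e b).eval A σ = F A (σ b))
    (hc : ∀ A b σ, (e b).cost A σ + 1 ≤ B (σ b).size)
    (hs : ∀ A x, (F A x).size ≤ B x.size) : RunsIn F B := by
  refine ⟨fun b => .assign b (e b), fun A b σ => ⟨_, _, .assign _ _ _, ?_, ?_, hc _ _ _, hs _ _⟩⟩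
  · simp [he]
  · intro x hx; simp [Function.update, hx.ne]

/-- Functions computable in polynomial time. -/
def PC (F : Set Data → Data → Data) : Prop := ∃ q : Polynomial ℕ, RunsIn F (fun n => q.eval n)

/-- Predicates decidable in polynomial time. -/
def DP (p : Set Data → Data → Prop) : Prop := PC fun A x => Data.ofProp (p A x)

theorem PC.comp {F G : Set Data → Data → Data} (hF : PC F) (hG : PC G) :
    PC fun A x => F A (G A x) := by
  obtain ⟨q, hq⟩ := hF
  obtain ⟨r, hr⟩ := hG
  refine ⟨q.comp r + r + 1, (hq.comp hr fun _ _ => polynomial_eval_mono q).mono fun n => ?_⟩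
  simp [Polynomial.eval_comp]

theorem PC.id : PC fun _ x => x := by
  refine ⟨2 * .X + 2, .expr (fun b => .var b) (fun _ _ _ => rfl) (fun A b σ => ?_) fun A x => ?_⟩
  · simp [Expr.cost]; omega
  · simp; omega

theorem PC.hd' : PC fun _ x => x.hd := by
  refine ⟨2 * .X + 2, .expr (fun b => .hd (.var b)) (fun _ _ _ => rfl) (fun A b σ => ?_)
    fun A x => ?_⟩
  · have := (σ b).size_hd_le; simp [Expr.cost, Expr.eval]; omega
  · have := x.size_hd_le; simp; omega

theorem PC.tl' : PC fun _ x => x.tl := by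
  refine ⟨2 * .X + 2, .expr (fun b => .tl (.var b)) (fun _ _ _ => rfl) (fun A b σ => ?_)
    fun A x => ?_⟩
  · have := (σ b).size_tl_le; simp [Expr.cost, Expr.eval]; omega
  · have := x.size_tl_le; simp; omega

theorem PC.nil : PC fun _ _ => .nil := by
  refine ⟨2, .expr (fun b => .nil) (fun _ _ _ => rfl) (fun A b σ => ?_) fun A x => ?_⟩
  · simp [Expr.cost]
  · simp [Data.size]

theorem DP.eq' : DP fun _ x => x.hd = x.tl := by
  refine ⟨4 * .X + 4, .expr (fun b => .eq (.hd (.var b)) (.tl (.var b))) (fun _ _ _ => rfl)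
    (fun A b σ => ?_) fun A x => ?_⟩
  · have := (σ b).size_tl_le
    have := (σ b).size_hd_le
    have := Data.size_ofProp_le ((σ b).hd = (σ b).tl)
    simp [Expr.cost, Expr.eval]; omega
  · have := Data.size_ofProp_le (x.hd = x.tl)
    simp; omega

theorem DP.query' : DP fun A x => x ∈ A := by
  refine ⟨4 * .X + 4, .expr (fun b => .query (.var b)) (fun _ _ _ => rfl)
    (fun A b σ => ?_) fun A x => ?_⟩
  · have := Data.size_ofProp_le (σ b ∈ A)
    simp [Expr.cost, Expr.eval]; omega
  · have := Data.size_ofProp_le (x ∈ A)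
    simp; omega

theorem PC.hd {F : Set Data → Data → Data} (h : PC F) : PC fun A x => (F A x).hd :=
  PC.hd'.comp h

theorem PC.tl {F : Set Data → Data → Data} (h : PC F) : PC fun A x => (F A x).tl :=
  PC.tl'.comp h

theorem PC.cons {F G : Set Data → Data → Data} (hF : PC F) (hG : PC G) :
    PC fun A x => .cons (F A x) (G A x) := by
  obtain ⟨q, P, hP⟩ := hF
  obtain ⟨r, Q, hQ⟩ := hG
  -- Running on a copy in `b + 1` keeps the input in `b` for the second run, and starting that one
  -- at `b + 2` keeps the first result in `b + 1`.
  refine ⟨2 * .X + 3 * q + 3 * r + 10, fun b => .seq (.assign (b + 1) (.var b)) (.seq (P (b + 1))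
    (.seq (.assign (b + 2) (.var b)) (.seq (Q (b + 2))
      (.assign b (.cons (.var (b + 1)) (.var (b + 2))))))), fun A b σ => ?_⟩
  obtain ⟨τ, t, h1, h2, h3, h4, h5⟩ := hP A (b + 1) (Function.update σ (b + 1) (σ b))
  have hb : τ b = σ b := by rw [h3 b (by omega)]; simp [Function.update]
  obtain ⟨υ, u, k1, k2, k3, k4, k5⟩ := hQ A (b + 2) (Function.update τ (b + 2) (τ b))
  have hb' : υ (b + 1) = τ (b + 1) := by rw [k3 _ (by omega)]; simp [Function.update]
  simp only [Function.update_self, hb] at h2 h4 h5 k2 k4 k5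
  refine ⟨_, _, .seq (.assign _ _ _) (.seq h1 (.seq (.assign _ _ _) (.seq k1 (.assign _ _ _)))),
    ?_, ?_, ?_, ?_⟩
  · simp [Expr.eval, hb', h2, k2]
  · intro x hx
    rw [Function.update_of_ne (by omega), k3 x (by omega), Function.update_of_ne (by omega),
      h3 x (by omega), Function.update_of_ne (by omega)]
  · simp [Expr.cost, Expr.eval, Data.size, hb, hb', h2, k2]; omega
  · simp [Data.size]; omega

theorem PC.const (d : Data) : PC fun _ _ => d := by
  induction d with
  | nil => exact PC.nil
  | cons a b iha ihb => exact iha.cons ihb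

theorem DP.eq {F G : Set Data → Data → Data} (hF : PC F) (hG : PC G) :
    DP fun A x => F A x = G A x := PC.comp DP.eq' (hF.cons hG)

theorem DP.query {F : Set Data → Data → Data} (hF : PC F) : DP fun A x => F A x ∈ A :=
  PC.comp DP.query' hF

theorem PC.ite {p : Set Data → Data → Prop} {F G : Set Data → Data → Data}
    [∀ A x, Decidable (p A x)] (hp : DP p)
    (hF : PC F) (hG : PC G) : PC fun A x => if p A x then F A x else G A x := by
  obtain ⟨q, P, hP⟩ := hp
  obtain ⟨r, Q, hQ⟩ := hF
  obtain ⟨s, R, hR⟩ := hG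
  refine ⟨.X + 2 * q + r + s + 10, fun b => .seq (.assign (b + 1) (.var b)) (.seq (P (b + 1))
    (.ite (.var (b + 1)) (Q b) (R b))), fun A b σ => ?_⟩
  obtain ⟨τ, t, h1, h2, h3, h4, h5⟩ := hP A (b + 1) (Function.update σ (b + 1) (σ b))
  have hb : τ b = σ b := by rw [h3 b (by omega)]; simp [Function.update]
  have hx : ∀ x < b, τ x = σ x := fun x hx => by
    rw [h3 x (by omega), Function.update_of_ne (by omega)]
  simp only [Function.update_self] at h2 h4 h5
  by_cases hc : p A (σ b)
  · obtain ⟨υ, u, k1, k2, k3, k4, k5⟩ := hQ A b τ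
    simp only [hb] at k2 k4 k5
    refine ⟨_, _, .seq (.assign _ _ _) (.seq h1 (.ite_true ?_ k1)), ?_, ?_, ?_, ?_⟩
    · simp [Expr.eval, h2, hc]
    · simp [k2, hc]
    · intro x hx'; rw [k3 x hx', hx x hx']
    · simp [Expr.cost, h2]; omega
    · simp [hc]; omega
  · obtain ⟨υ, u, k1, k2, k3, k4, k5⟩ := hR A b τ
    simp only [hb] at k2 k4 k5
    refine ⟨_, _, .seq (.assign _ _ _) (.seq h1 (.ite_false ?_ k1)), ?_, ?_, ?_, ?_⟩
    · simp [Expr.eval, h2, hc]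
    · simp [k2, hc]
    · intro x hx'; rw [k3 x hx', hx x hx']
    · simp [Expr.cost, h2]; omega
    · simp [hc]; omega

/-! ### Boolean combinations of decidable predicates -/

theorem DP.of_ite {p q r : Set Data → Data → Prop} (hp : DP p) (hq : DP q) (hr : DP r) :
    DP fun A x => if p A x then q A x else r A x := by
  have := PC.ite hp hq hr
  unfold DP
  convert this using 3
  dsimp only
  split <;> rfl

theorem DP.true : DP fun _ _ => True := PC.const _
theorem DP.false : DP fun _ _ => False := PC.const _

theorem DP.and {p q : Set Data → Data → Prop} (hp : DP p) (hq : DP q) :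
    DP fun A x => p A x ∧ q A x := by
  convert DP.of_ite hp hq DP.false using 3; split <;> simp_all

theorem DP.not {p : Set Data → Data → Prop} (hp : DP p) : DP fun A x => ¬ p A x := by
  convert DP.of_ite hp DP.false DP.true using 3; split <;> simp_all

theorem DP.imp {p q : Set Data → Data → Prop} (hp : DP p) (hq : DP q) :
    DP fun A x => p A x → q A x := by
  convert DP.of_ite hp hq DP.true using 3; split <;> simp_all

theorem DP.iff {p q : Set Data → Data → Prop} (hp : DP p) (hq : DP q) :
    DP fun A x => (p A x ↔ q A x) := by
  convert (hp.imp hq).and (hq.imp hp) using 3; exact iff_def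

/-! ### Loops -/

/-- A loop whose body and test are computable in polynomial time takes time polynomial in any
bound on the number of rounds and on the sizes of the intermediate states. -/
theorem RunsIn.loop {p : Set Data → Data → Prop} {F I : Set Data → Data → Data} (hp : DP p)
    (hF : PC F) (hI : PC I) : ∃ q : Polynomial ℕ, ∀ (N : Set Data → Data → ℕ) (B : ℕ → ℕ),
      (∀ A x, ∀ i < N A x, p A ((F A)^[i] (I A x))) → (∀ A x, ¬ p A ((F A)^[N A x] (I A x))) →
      (∀ A x, N A x ≤ B x.size) → (∀ A x, ∀ i ≤ N A x, ((F A)^[i] (I A x)).size ≤ B x.size) →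
      RunsIn (fun A x => (F A)^[N A x] (I A x)) fun n => q.eval (B n + n) := by
  obtain ⟨q, P, hP⟩ := hp
  obtain ⟨r, Q, hQ⟩ := hF
  obtain ⟨s, R, hR⟩ := hI
  -- Variable `b + 1` holds the value of the test for the current state. The polynomial is fixed
  -- before `N` and `B`, so these may be exponential.
  refine ⟨s + .X * (.X + 2 * q + r + 20) + (2 * .X + 2 * q + 20), fun N B hp hnp hN hB =>
    ⟨fun b => .seq (R b) (.seq (.seq (.assign (b + 1) (.var b)) (P (b + 1)))
      (.loop (.var (b + 1)) (.seq (Q b) (.seq (.assign (b + 1) (.var b)) (P (b + 1)))))),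
      fun A b σ => ?_⟩⟩
  have test : ∀ (σ : Store) (m : ℕ), (σ b).size ≤ m → ∃ τ t,
      Exec A (.seq (.assign (b + 1) (.var b)) (P (b + 1))) σ τ t ∧ (∀ x < b + 1, τ x = σ x) ∧
        τ (b + 1) = Data.ofProp (p A (σ b)) ∧ t ≤ m + q.eval m + 5 := by
    intro σ m hm
    obtain ⟨τ, t, h1, h2, h3, h4, h5⟩ := hP A (b + 1) (Function.update σ (b + 1) (σ b))
    simp only [Function.update_self] at h2 h4
    have := polynomial_eval_mono q hm
    refine ⟨_, _, .seq (.assign _ _ _) h1, fun x hx => ?_, h2, ?_⟩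
    · rw [h3 x hx, Function.update_of_ne (by omega)]
    · simp [Expr.cost]; omega
  have rounds : ∀ (n m : ℕ) (σ : Store), σ (b + 1) = Data.ofProp (p A (σ b)) →
      (∀ i < n, p A ((F A)^[i] (σ b))) → ¬ p A ((F A)^[n] (σ b)) →
      (∀ i ≤ n, ((F A)^[i] (σ b)).size ≤ m) → ∃ τ t,
      Exec A (.loop (.var (b + 1)) (.seq (Q b) (.seq (.assign (b + 1) (.var b)) (P (b + 1)))))
        σ τ t ∧ τ b = (F A)^[n] (σ b) ∧ (∀ x < b, τ x = σ x) ∧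
        t ≤ n * (m + 2 * q.eval m + r.eval m + 20) + 10 := by
    intro n m
    induction n with
    | zero =>
      intro σ h1 _ h2 _
      refine ⟨_, _, .loop_done (by simpa [Expr.eval, h1] using h2), rfl, fun _ _ => rfl, ?_⟩
      have := Data.size_ofProp_le (p A (σ b))
      simp [Expr.cost, h1]; omega
    | succ n ih =>
      intro σ h1 h2 h3 h4
      obtain ⟨τ, t, k1, k2, k3, k4, k5⟩ := hQ A b σ
      obtain ⟨υ, u, l1, l2, l3, l4⟩ := test τ m (by rw [k2]; exact h4 1 (by omega))
      have hυ : υ b = F A (σ b) := by rw [l2 b (by omega), k2]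
      obtain ⟨ω, v, m1, m2, m3, m4⟩ := ih υ (by rw [l3, l2 b (by omega)])
        (fun i hi => by rw [hυ]; exact h2 (i + 1) (by omega)) (by rw [hυ]; exact h3)
        (fun i hi => by rw [hυ]; exact h4 (i + 1) (by omega))
      refine ⟨ω, _, .loop_step ?_ (.seq k1 l1) m1, by rw [m2, hυ]; rfl, fun x hx => ?_, ?_⟩
      · simpa [Expr.eval, h1] using h2 0 (by omega)
      · rw [m3 x hx, l2 x (by omega), k3 x hx]
      · have := Data.size_ofProp_le (p A (σ b))
        have := polynomial_eval_mono r (h4 0 (by omega))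
        simp only [Function.iterate_zero, id] at this
        dsimp only at k4
        simp only [Expr.cost, h1]
        rw [Nat.add_mul]
        omega
  obtain ⟨ρ, v, l1, l2, l3, l4, l5⟩ := hR A b σ
  obtain ⟨τ, t, h1, h2, h3, h4⟩ := test ρ (B (σ b).size)
    (by rw [l2]; exact hB A (σ b) 0 (Nat.zero_le _))
  have hb := h2 b (by omega)
  obtain ⟨υ, u, k1, k2, k3, k4⟩ := rounds (N A (σ b)) (B (σ b).size) τ (by rw [h3, hb])
    (by rw [hb, l2]; exact hp A _) (by rw [hb, l2]; exact hnp A _) (by rw [hb, l2]; exact hB A _)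
  have hle : B (σ b).size ≤ B (σ b).size + (σ b).size := Nat.le_add_right _ _
  have e1 := polynomial_eval_mono q hle
  have e2 := polynomial_eval_mono r hle
  have e3 := polynomial_eval_mono s (Nat.le_add_left (σ b).size (B (σ b).size))
  dsimp only at l4 ⊢
  refine ⟨υ, _, .seq l1 (.seq h1 k1), by rw [k2, hb, l2],
    fun x hx => by rw [k3 x hx, h2 x (by omega), l3 x hx], ?_, ?_⟩
  · have := Nat.mul_le_mul ((hN A (σ b)).trans hle) (Nat.add_le_add_right (Nat.add_le_add
      (Nat.add_le_add hle (Nat.mul_le_mul_left 2 e1)) e2) 20)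
    simp only [Polynomial.eval_add, Polynomial.eval_mul, Polynomial.eval_X,
      Polynomial.eval_ofNat]
    omega
  · have := hB A (σ b) _ le_rfl
    simp only [Polynomial.eval_add, Polynomial.eval_mul, Polynomial.eval_X,
      Polynomial.eval_ofNat]
    omega

theorem PC.loop {p : Set Data → Data → Prop} {F I : Set Data → Data → Data} (hp : DP p)
    (hF : PC F) (hI : PC I) (N : Set Data → Data → ℕ) (q : Polynomial ℕ)
    (h1 : ∀ A x, ∀ i < N A x, p A ((F A)^[i] (I A x))) (h2 : ∀ A x, ¬ p A ((F A)^[N A x] (I A x)))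
    (h3 : ∀ A x, N A x ≤ q.eval x.size)
    (h4 : ∀ A x, ∀ i ≤ N A x, ((F A)^[i] (I A x)).size ≤ q.eval x.size) :
    PC fun A x => (F A)^[N A x] (I A x) := by
  obtain ⟨r, hr⟩ := RunsIn.loop hp hF hI
  refine ⟨r.comp (q + .X), (hr N (fun n => q.eval n) h1 h2 h3 h4).mono fun n => ?_⟩
  simp [Polynomial.eval_comp]

theorem PC.size_le {F : Set Data → Data → Data} (h : PC F) :
    ∃ q : Polynomial ℕ, ∀ A x, (F A x).size ≤ q.eval x.size := by
  obtain ⟨q, P, hP⟩ := h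
  refine ⟨q, fun A x => ?_⟩
  obtain ⟨_, _, _, _, _, _, h⟩ := hP A 0 fun _ => x
  exact h

/-! ### Folds -/

theorem size_encList_drop_le (l : List Data) (i : ℕ) :
    (encList (l.drop i)).size ≤ (encList l).size := by
  induction l generalizing i with
  | nil => simp
  | cons a l ih =>
    cases i with
    | zero => simp
    | succ i => have := ih i; simp [encList, Data.size]; omega

/-- Folds over lists take time polynomial in any bound on the intermediate results. -/
theorem RunsIn.foldl {f : Set Data → Data → Data → Data → Data} {l s : Set Data → Data → Data}
    (hf : PC fun A z => f A z.hd.hd z.hd.tl z.tl) (hl : PC l) (hs : PC s) :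
    ∃ q : Polynomial ℕ, ∀ B : ℕ → ℕ,
      (∀ A x l', l' <+: (l A x).toList → (l'.foldl (f A x) (s A x)).size ≤ B x.size) →
      RunsIn (fun A x => (l A x).toList.foldl (f A x) (s A x)) fun n => q.eval (B n + n) := by
  -- The state consists of the remaining list, the input and the accumulator. The input travels
  -- along because `f` may depend on it.
  let F : Set Data → Data → Data := fun A z =>
    .cons z.hd.tl (.cons z.tl.hd (f A z.tl.hd z.tl.tl z.hd.hd))
  have hF : PC F := PC.id.hd.tl.cons <| PC.id.tl.hd.cons <|
    hf.comp ((PC.id.tl.hd.cons PC.id.tl.tl).cons PC.id.hd.hd)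
  have hI : PC fun A x => .cons (l A x) (.cons x (s A x)) := hl.cons (PC.id.cons hs)
  have hp : DP fun _ z => ¬ z.hd = .nil := (DP.eq PC.id.hd PC.nil).not
  obtain ⟨q, hq⟩ := RunsIn.loop hp hF hI
  obtain ⟨r, hr⟩ := PC.tl'.comp PC.tl'
  obtain ⟨p, hlsize⟩ := hl.size_le
  let p' : Polynomial ℕ := 2 * .X + p + 10
  refine ⟨r.comp (q.comp p') + q.comp p' + 1, fun B hB => ?_⟩
  have key : ∀ A x i, (F A)^[i] (.cons (l A x) (.cons x (s A x))) =
      .cons (encList ((l A x).toList.drop i))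
        (.cons x (((l A x).toList.take i).foldl (f A x) (s A x))) ∨
      (l A x).toList.length < i := by
    intro A x i
    induction i with
    | zero => left; simp
    | succ i ih =>
      rcases ih with ih | ih
      · by_cases hi : i < (l A x).toList.length
        · left
          rw [Function.iterate_succ_apply', ih]
          simp only [F, Data.hd_cons, Data.tl_cons]
          rw [List.drop_eq_getElem_cons hi, List.take_add_one, List.foldl_append]
          simp [encList, hi]
        · right; omega
      · right; omega
  have key' : ∀ A x, ∀ i ≤ (l A x).toList.length, _ := fun A x i hi =>
    (key A x i).resolve_right (by omega)
  have main := hq (fun A x => (l A x).toList.length) (fun n => B n + n + p.eval n + 10) ?_ ?_ ?_ ?_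
  · have h := (hr.comp main fun _ _ => polynomial_eval_mono r).mono
      (B' := fun n => (r.comp (q.comp p') + q.comp p' + 1).eval (B n + n)) fun n => ?_
    · convert h using 3 with A x
      rw [key' A x _ le_rfl]
      simp
    · have e1 := polynomial_eval_mono p (Nat.le_add_left n (B n))
      have e2 := polynomial_eval_mono q (show B n + n + p.eval n + 10 + n ≤
        2 * (B n + n) + p.eval (B n + n) + 10 by omega)
      have e3 := polynomial_eval_mono r e2
      simp only [p', Polynomial.eval_comp, Polynomial.eval_add, Polynomial.eval_mul,
        Polynomial.eval_X, Polynomial.eval_ofNat, Polynomial.eval_one]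
      omega
  · intro A x i hi h
    rw [key' A x i hi.le, List.drop_eq_getElem_cons hi] at h
    simp [encList] at h
  · intro A x
    rw [key' A x _ le_rfl]
    simp [encList]
  · intro A x
    have := hlsize A x
    have := (l A x).length_toList_lt
    omega
  · intro A x i hi
    rw [key' A x i hi]
    have h1 := hB A x _ (List.take_prefix i _)
    have h2 := size_encList_drop_le (l A x).toList i
    rw [encList_toList] at h2
    have h3 := hlsize A x
    simp only [Data.size]
    omega

theorem PC.foldl {f : Set Data → Data → Data → Data → Data} {l s : Set Data → Data → Data}
    (hf : PC fun A z => f A z.hd.hd z.hd.tl z.tl) (hl : PC l) (hs : PC s) (q : Polynomial ℕ)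
    (hq : ∀ A x l', l' <+: (l A x).toList → (l'.foldl (f A x) (s A x)).size ≤ q.eval x.size) :
    PC fun A x => (l A x).toList.foldl (f A x) (s A x) := by
  obtain ⟨r, hr⟩ := RunsIn.foldl hf hl hs
  refine ⟨r.comp (q + .X), (hr (fun n => q.eval n) hq).mono fun n => ?_⟩
  simp [Polynomial.eval_comp]

/-! ### List operations -/

def Data.append (a b : Data) : Data := encList (a.toList ++ b.toList)

def Data.reverse (a : Data) : Data := encList a.toList.reverse

def Data.bind (a : Data) (f : Data → Data) : Data :=
  encList (a.toList.flatMap fun y => (f y).toList)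

def Data.map (a : Data) (f : Data → Data) : Data := encList (a.toList.map f)

noncomputable def Data.filter (a : Data) (p : Data → Prop) : Data :=
  encList (a.toList.filter fun y => p y)

@[simp] theorem Data.toList_append (a b : Data) :
    (a.append b).toList = a.toList ++ b.toList := toList_encList _

@[simp] theorem Data.toList_reverse (a : Data) : a.reverse.toList = a.toList.reverse :=
  toList_encList _

@[simp] theorem Data.toList_bind (a : Data) (f : Data → Data) :
    (a.bind f).toList = a.toList.flatMap fun y => (f y).toList := toList_encList _

@[simp] theorem Data.toList_map (a : Data) (f : Data → Data) :
    (a.map f).toList = a.toList.map f := toList_encList _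

@[simp] theorem Data.toList_filter (a : Data) (p : Data → Prop) :
    (a.filter p).toList = a.toList.filter fun y => p y := toList_encList _

theorem foldl_cons_eq (l : List Data) (a : Data) :
    l.foldl (fun acc y => Data.cons y acc) a = encList (l.reverse ++ a.toList) := by
  induction l generalizing a with
  | nil => simp
  | cons x l ih => simp [ih]

theorem Data.size_append (a b : Data) : (a.append b).size + 1 = a.size + b.size := by
  rw [Data.append, size_encList, a.size_eq_sum, b.size_eq_sum]
  simp; omega

theorem Data.size_reverse (a : Data) : a.reverse.size = a.size := by
  rw [Data.reverse, size_encList, a.size_eq_sum]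
  simp

theorem size_encList_le_of_prefix {l m : List Data} (h : l <+: m) :
    (encList l).size ≤ (encList m).size := by
  obtain ⟨k, rfl⟩ := h
  simp [size_encList]

theorem PC.reverse {F : Set Data → Data → Data} (hF : PC F) : PC fun A x => (F A x).reverse := by
  have : PC fun _ x => x.reverse := by
    convert PC.foldl (f := fun _ _ acc y => .cons y acc) (PC.id.tl.cons PC.id.hd.tl) PC.id PC.nil
      .X ?_ using 3
    · simp [foldl_cons_eq, Data.reverse]
    · intro A x l' hl'
      have := size_encList_le_of_prefix hl'
      have h2 := Data.size_reverse (encList l')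
      simp only [Data.reverse, toList_encList, encList_toList] at h2 this
      simp [foldl_cons_eq, h2, this]
  exact this.comp hF

theorem PC.append {F G : Set Data → Data → Data} (hF : PC F) (hG : PC G) :
    PC fun A x => (F A x).append (G A x) := by
  -- Prepending the members of the reversed first list one by one to the second list appends the
  -- two; the double reversal cancels afterwards.
  have : PC fun _ x => x.hd.reverse.reverse.append x.tl := by
    convert PC.foldl (f := fun _ _ acc y => .cons y acc) (PC.id.tl.cons PC.id.hd.tl)
      PC.id.hd.reverse PC.id.tl (2 * .X) ?_ using 3
    · rw [foldl_cons_eq]; simp [Data.append]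
    · intro A x l' hl'
      have := size_encList_le_of_prefix hl'
      have h2 := Data.size_append (encList l').reverse x.tl
      rw [Data.size_reverse] at h2
      rw [encList_toList, Data.size_reverse] at this
      have := x.size_hd_le
      have := x.size_tl_le
      simp only [Data.append, Data.toList_reverse, toList_encList] at h2
      simp only [foldl_cons_eq, Polynomial.eval_mul, Polynomial.eval_X, Polynomial.eval_ofNat]
      omega
  convert this.comp (hF.cons hG) using 3
  simp [Data.append]

theorem Data.size_bind_le (a : Data) (f : Data → Data) (m : ℕ)
    (h : ∀ y ∈ a.toList, (f y).size ≤ m) : (a.bind f).size ≤ 1 + a.toList.length * m := by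
  rw [Data.bind, size_encList]
  generalize a.toList = l at h
  induction l with
  | nil => simp
  | cons x l ih =>
    have h1 := ih fun y hy => h y (by simp [hy])
    have h2 := h x (by simp)
    rw [Data.size_eq_sum] at h2
    simp only [List.flatMap_cons, List.map_append, List.sum_append, List.length_cons, Nat.add_mul]
    omega

/-- The list has at most `p` members, and `f` yields a tree of size at most `q` of the size of a
pair of the input and a member; this bounds every intermediate concatenation. -/
theorem PC.bind {f : Set Data → Data → Data → Data} {l : Set Data → Data → Data}
    (hl : PC l) (hf : PC fun A z => f A z.hd z.tl) :
    PC fun A x => (l A x).bind (f A x) := by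
  obtain ⟨p, hp⟩ := hl.size_le
  obtain ⟨q, hq⟩ := hf.size_le
  have aux : ∀ (l : List Data) (f : Data → Data) (a : Data),
      l.foldl (fun acc y => acc.append (f y)) a = a.append ((encList l).bind f) := by
    intro l f
    induction l with
    | nil => intro a; simp [Data.append, Data.bind, encList]
    | cons x l ih => intro a; simp [ih, encList]; simp [Data.append, Data.bind]
  have hf' : PC fun A z => z.hd.tl.append (f A z.hd.hd z.tl) :=
    PC.id.hd.tl.append (hf.comp (PC.id.hd.hd.cons PC.id.tl))
  convert PC.foldl (f := fun A x acc y => acc.append (f A x y)) hf' hl PC.nil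
    (1 + p * q.comp (.X + p + 1)) ?_ using 3 with A x
  · rw [aux]; simp [Data.append, Data.bind]
  · intro A x l' hl'
    rw [aux]
    have h1 := Data.size_append .nil ((encList l').bind (f A x))
    have h2 := Data.size_bind_le (encList l') (f A x) (q.eval (x.size + p.eval x.size + 1)) ?_
    · have h3 : l'.length ≤ p.eval x.size :=
        hl'.length_le.trans ((l A x).length_toList_lt.le.trans (hp A x))
      have h4 := Nat.mul_le_mul_right (q.eval (x.size + p.eval x.size + 1)) h3
      simp only [toList_encList] at h2
      simp only [Data.size, Polynomial.eval_comp, Polynomial.eval_add, Polynomial.eval_mul,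
        Polynomial.eval_X, Polynomial.eval_one] at h1 ⊢
      omega
    · intro y hy
      rw [toList_encList] at hy
      refine (hq A (.cons x y)).trans (polynomial_eval_mono q ?_)
      have := Data.size_lt_of_mem (hl'.subset hy)
      have := hp A x
      simp only [Data.size]
      omega

theorem PC.map {f : Set Data → Data → Data → Data} {l : Set Data → Data → Data}
    (hl : PC l) (hf : PC fun A z => f A z.hd z.tl) :
    PC fun A x => (l A x).map (f A x) := by
  convert PC.bind (f := fun A x y => .cons (f A x y) .nil) hl (hf.cons PC.nil) using 3
  simp [Data.map, Data.bind, List.map_eq_flatMap]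

theorem PC.filter {p : Set Data → Data → Data → Prop} {l : Set Data → Data → Data}
    (hl : PC l) (hp : DP fun A z => p A z.hd z.tl) :
    PC fun A x => (l A x).filter (p A x) := by
  convert PC.bind (f := fun A x y => if p A x y then .cons y .nil else .nil) hl
    (PC.ite hp (PC.id.tl.cons PC.nil) PC.nil) using 3 with A x
  rw [Data.filter, Data.bind]
  congr 1
  induction (l A x).toList with
  | nil => rfl
  | cons y l ih =>
    rw [List.filter_cons, List.flatMap_cons, ← ih]
    by_cases h : p A x y <;> simp [h]

/-! ### Bounded quantifiers and membership -/

theorem DP.exists_mem {p : Set Data → Data → Data → Prop} {l : Set Data → Data → Data}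
    (hl : PC l) (hp : DP fun A z => p A z.hd z.tl) :
    DP fun A x => ∃ y ∈ (l A x).toList, p A x y := by
  convert (DP.eq (hl.filter hp) PC.nil).not using 3 with A x
  rw [← Data.toList_eq_nil]
  simp

theorem DP.forall_mem {p : Set Data → Data → Data → Prop} {l : Set Data → Data → Data}
    (hl : PC l) (hp : DP fun A z => p A z.hd z.tl) :
    DP fun A x => ∀ y ∈ (l A x).toList, p A x y := by
  convert (DP.exists_mem (p := fun A x y => ¬ p A x y) hl hp.not).not using 3 with A x
  simp

theorem DP.mem {F l : Set Data → Data → Data} (hF : PC F) (hl : PC l) :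
    DP fun A x => F A x ∈ (l A x).toList := by
  have : DP fun A x => ∃ y ∈ x.tl.toList, y = x.hd :=
    DP.exists_mem PC.id.tl (DP.eq PC.id.tl PC.id.hd.hd)
  have h := PC.comp this (hF.cons hl)
  simpa [DP] using h

/-! ### Concept terms as trees -/

def Data.tTop : Data := .cons (encUnary 0) .nil
def Data.tNeg (x : Data) : Data := .cons (encUnary 2) x
def Data.tInf (x y : Data) : Data := .cons (encUnary 3) (.cons x y)
def Data.tEx (r x : Data) : Data := .cons (encUnary 4) (.cons r x)

/-- A placeholder for a concept that is defined elsewhere. -/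
def Data.tMac (k t : Data) : Data := .cons (encUnary 5) (.cons k t)

/-- The conjunction of a list of terms. -/
def Data.conj (a : Data) : Data := a.toList.foldr Data.tInf Data.tTop

theorem PC.tNeg {F : Set Data → Data → Data} (hF : PC F) : PC fun A x => (F A x).tNeg :=
  (PC.const _).cons hF

theorem PC.tEx {F G : Set Data → Data → Data} (hF : PC F) (hG : PC G) :
    PC fun A x => (F A x).tEx (G A x) :=
  (PC.const _).cons (hF.cons hG)

theorem PC.tMac {F G : Set Data → Data → Data} (hF : PC F) (hG : PC G) :
    PC fun A x => (F A x).tMac (G A x) :=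
  (PC.const _).cons (hF.cons hG)

theorem size_encUnary (n : ℕ) : (encUnary n).size = 1 + 2 * n := by
  simp [encUnary, size_encList, Data.size]; omega

theorem PC.conj {F : Set Data → Data → Data} (hF : PC F) : PC fun A x => (F A x).conj := by
  have : PC fun _ x => x.conj := by
    convert PC.foldl (f := fun _ _ acc y => Data.tInf y acc)
      ((PC.const (encUnary 3)).cons (PC.id.tl.cons PC.id.hd.tl)) PC.id.reverse (PC.const Data.tTop)
      (9 * .X) ?_ using 3
    · simp [Data.conj]
    · intro A x l' hl'
      have h1 := size_encList_le_of_prefix hl'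
      rw [encList_toList, Data.size_reverse] at h1
      have h2 : ∀ (l : List Data) (a : Data),
          (l.foldl (fun acc y => Data.tInf y acc) a).size + 9 ≤ a.size + 9 * (encList l).size := by
        intro l
        induction l with
        | nil => simp [encList, Data.size]
        | cons y l ih =>
          intro a
          have := ih (Data.tInf y a)
          simp only [List.foldl_cons, encList, Data.size]
          simp only [Data.tInf, Data.size, size_encUnary] at this ⊢
          omega
      have h3 := h2 l' Data.tTop
      simp only [Data.tTop, Data.size, size_encUnary] at h3
      simp only [Data.tTop, Polynomial.eval_mul, Polynomial.eval_X, Polynomial.eval_ofNat]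
      omega
  exact this.comp hF

/-! ### Counters and positions -/

/-- The unary numerals up to the length of a list. -/
def Data.levels (a : Data) : Data := encList ((List.range (a.toList.length + 1)).map encUnary)

/-- The length of a list in unary. -/
def Data.len (a : Data) : Data := encUnary a.toList.length

/-- The position of a tree in a list in unary. -/
noncomputable def Data.idx (a y : Data) : Data := encUnary (a.toList.idxOf y)

theorem PC.len {F : Set Data → Data → Data} (hF : PC F) : PC fun A x => (F A x).len := by
  convert PC.map (f := fun _ _ _ => .nil) hF PC.nil using 3
  simp [Data.map, Data.len, encUnary]

theorem size_encList_le_mul {l : List Data} {m : ℕ} (h : ∀ x ∈ l, x.size ≤ m) :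
    (encList l).size ≤ 1 + l.length * (1 + m) := by
  rw [size_encList]
  have := List.sum_le_card_nsmul (l.map fun a => 1 + a.size) (1 + m) (by simpa using h)
  simpa using this

theorem PC.levels {F : Set Data → Data → Data} (hF : PC F) : PC fun A x => (F A x).levels := by
  have key : ∀ l : List Data, l.foldl (fun acc _ => acc.append (.cons acc.len .nil)) .nil =
      encList ((List.range l.length).map encUnary) := by
    intro l
    induction l using List.reverseRecOn with
    | nil => rfl
    | append_singleton l y ih =>
      rw [List.foldl_append, ih]
      simp [Data.append, Data.len, List.range_succ]
  have : PC fun _ x => x.levels := by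
    convert PC.foldl (f := fun _ _ acc _ => acc.append (.cons acc.len .nil))
      (PC.id.hd.tl.append (PC.id.hd.tl.len.cons PC.nil)) (PC.nil.cons PC.id) PC.nil
      (1 + (.X + 1) * (1 + (1 + 2 * (.X + 1)))) ?_ using 3 with A x
    · rw [key]; simp [Data.levels]
    · intro A x l' hl'
      rw [key]
      have h1 := hl'.length_le
      have h2 := x.length_toList_lt
      simp only [Data.toList_cons, List.length_cons] at h1
      refine (size_encList_le_mul (m := 1 + 2 * (x.size + 1)) ?_).trans ?_
      · simp only [List.mem_map, List.mem_range]
        rintro _ ⟨i, hi, rfl⟩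
        rw [size_encUnary]; omega
      · simp only [List.length_map, List.length_range, Polynomial.eval_add, Polynomial.eval_mul,
          Polynomial.eval_X, Polynomial.eval_ofNat, Polynomial.eval_one]
        gcongr
        omega
  exact this.comp hF

theorem PC.idx {F G : Set Data → Data → Data} (hF : PC F) (hG : PC G) :
    PC fun A x => (F A x).idx (G A x) := by
  -- The accumulator is a flag for `y` having been met, together with a unary counter that stops at
  -- the first occurrence.
  let f : Data → Data → Data → Data := fun y acc z =>
    if acc.hd = .nil then
      if z = y then .cons (.cons .nil .nil) acc.tl else .cons .nil (.cons .nil acc.tl)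
    else acc
  have hf : PC fun _ z => f z.hd.hd.hd z.hd.tl z.tl :=
    PC.ite (DP.eq PC.id.hd.tl.hd PC.nil)
      (PC.ite (DP.eq PC.id.tl PC.id.hd.hd.hd) ((PC.const _).cons PC.id.hd.tl.tl)
        (PC.nil.cons (PC.nil.cons PC.id.hd.tl.tl))) PC.id.hd.tl
  have key : ∀ (y : Data) (l : List Data), l.foldl (f y) (.cons .nil .nil) =
      .cons (Data.ofProp (y ∈ l)) (encUnary (l.idxOf y)) := by
    intro y l
    induction l using List.reverseRecOn with
    | nil => simp [Data.ofProp, encUnary, encList]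
    | append_singleton l z ih =>
      rw [List.foldl_append, ih]
      by_cases h : y ∈ l
      · simp [f, h, List.idxOf_append]
      · by_cases hz : z = y
        · simp [f, h, hz, List.idxOf_append, Data.ofProp]
        · simp [f, h, hz, Data.ofProp, Ne.symm hz, encUnary, List.idxOf_of_notMem,
            List.replicate_succ, encList]
  have : PC fun _ x => (Data.cons x.hd x.tl).tl.idx x.hd := by
    have h := PC.foldl (f := fun _ x acc z => f x.hd acc z) hf PC.id.tl
      (PC.const (.cons .nil .nil)) (2 * .X + 10) ?_
    · convert h.tl using 3
      rw [key]; simp [Data.idx]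
    · intro A x l' hl'
      rw [key]
      have h1 := hl'.length_le
      have h2 := x.tl.length_toList_lt
      have h3 := x.size_tl_le
      have h4 := Data.size_ofProp_le (x.hd ∈ l')
      have h5 := List.idxOf_le_length (l := l') (a := x.hd)
      simp only [Data.size, size_encUnary, Polynomial.eval_add, Polynomial.eval_mul,
        Polynomial.eval_X, Polynomial.eval_ofNat]
      omega
  exact this.comp (hG.cons hF)

/-! ### Depth-first search -/

/-- The state is a stack and an output list. A popped tree is put in front of the output; its kids
are popped later and so end up before it. Nothing is marked as visited, so repetitions may occur. -/
noncomputable def dfsStep (kids : Data → Data) (z : Data) : Data :=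
  if z.hd = .nil then z
  else .cons ((kids z.hd.hd).append z.hd.tl) (.cons z.hd.hd z.tl)

/-- The list of all trees reached from `x` by `kids`, each of them after all its kids. -/
noncomputable def dfs (kids : Data → Data) (x : Data) : Data :=
  ((dfsStep kids)^[x.size] (.cons (.cons x .nil) .nil)).tl

/-- The total size of the members of a list. -/
def Data.total (a : Data) : ℕ := (a.toList.map Data.size).sum

/-- The list `l` contains each of its members only after all kids of that member. -/
def KidsFirst (kids : Data → Data) (l : List Data) : Prop :=
  ∀ P y R, l = P ++ y :: R → ∀ z ∈ (kids y).toList, z ∈ P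

/-- Replacing a tree on the stack by its kids lowers the total size of the stack, so that size
bounds the number of steps. The last clause is an induction principle: a property inherited by kids
passes from the stack to everything visited. -/
theorem dfs_run (kids : Data → Data) (hk : ∀ x, (kids x).total < x.size) (n : ℕ) :
    ∀ st out : Data, st.total ≤ n → ∃ new : List Data,
      (dfsStep kids)^[n] (.cons st out) = .cons .nil (encList (new ++ out.toList)) ∧
      (∀ x ∈ st.toList, x ∈ new) ∧ KidsFirst kids new ∧
      ∀ Q : Data → Prop, (∀ x, Q x → ∀ y ∈ (kids x).toList, Q y) → (∀ x ∈ st.toList, Q x) →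
        ∀ x ∈ new, Q x := by
  induction n with
  | zero =>
    intro st out hst
    cases st with
    | nil => exact ⟨[], by simp, by simp, by simp [KidsFirst], by simp⟩
    | cons y st => have := y.size_pos; simp [Data.total] at hst; omega
  | succ n ih =>
    intro st out hst
    cases st with
    | nil =>
      obtain ⟨new, h1, h2⟩ := ih .nil out (by simp [Data.total])
      refine ⟨new, ?_, h2⟩
      rw [Function.iterate_succ_apply, ← h1]
      simp [dfsStep]
    | cons y st =>
      have hy := hk y
      obtain ⟨new, h1, h2, h3, h4⟩ := ih ((kids y).append st) (.cons y out) (by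
        simp [Data.total] at hst hy ⊢; omega)
      refine ⟨new ++ [y], ?_, ?_, ?_, ?_⟩
      · rw [Function.iterate_succ_apply]
        simp [dfsStep, h1]
      · simp at h2 ⊢
        exact fun x hx => Or.inl (h2 x (Or.inr hx))
      · intro P z R h w hw
        rcases List.eq_nil_or_concat R with rfl | ⟨R, v, rfl⟩
        · obtain ⟨rfl, hz⟩ := List.append_inj' h rfl
          simp at hz; subst hz
          exact h2 w (by simp [hw])
        · rw [List.concat_eq_append, ← List.cons_append, ← List.append_assoc] at h
          obtain ⟨rfl, hz⟩ := List.append_inj' h rfl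
          exact h3 P z R rfl w hw
      · intro Q hQ hst x hx
        simp at hst hx
        rcases hx with hx | rfl
        · refine h4 Q hQ ?_ x hx
          simp
          rintro z (hz | hz)
          · exact hQ y hst.1 z hz
          · exact hst.2 z hz
        · exact hst.1

theorem dfs_spec (kids : Data → Data) (hk : ∀ x, (kids x).total < x.size) (x : Data) :
    x ∈ (dfs kids x).toList ∧ KidsFirst kids (dfs kids x).toList ∧
      ∀ Q : Data → Prop, (∀ x, Q x → ∀ y ∈ (kids x).toList, Q y) → Q x →
        ∀ y ∈ (dfs kids x).toList, Q y := by
  obtain ⟨new, h1, h2, h3, h4⟩ := dfs_run kids hk x.size (.cons x .nil) .nil (by simp [Data.total])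
  have : (dfs kids x).toList = new := by rw [dfs, h1]; simp
  rw [this]
  refine ⟨h2 x (by simp), h3, fun Q hQ hx => h4 Q hQ (by simpa using hx)⟩

theorem PC.dfs {kids : Data → Data} (hk : ∀ x, (kids x).total < x.size)
    (hkids : PC fun _ x => kids x) {F : Set Data → Data → Data} (hF : PC F) :
    PC fun A x => dfs kids (F A x) := by
  have hstep : PC fun _ x => dfsStep kids x := PC.ite (DP.eq PC.id.hd PC.nil) PC.id
    (((hkids.comp PC.id.hd.hd).append PC.id.hd.tl).cons (PC.id.hd.hd.cons PC.id.tl))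
  have hend : ∀ x : Data, ((dfsStep kids)^[x.size] (.cons (.cons x .nil) .nil)).hd = .nil := by
    intro x
    obtain ⟨new, h1, -⟩ := dfs_run kids hk x.size (.cons x .nil) .nil (by simp [Data.total])
    rw [h1]; rfl
  have hidle : ∀ (z : Data) (i : ℕ), z.hd = .nil → (dfsStep kids)^[i] z = z := by
    intro z i hz
    exact Function.iterate_fixed (by simp [dfsStep, hz]) i
  have hsize : ∀ (x : Data) (i : ℕ), ∃ st out : Data,
      (dfsStep kids)^[i] (.cons (.cons x .nil) .nil) = .cons st out ∧ st.total ≤ x.size ∧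
        out.size ≤ 1 + i * (x.size + 1) := by
    intro x i
    induction i with
    | zero => exact ⟨_, _, rfl, by simp [Data.total], by simp [Data.size]⟩
    | succ i ih =>
      obtain ⟨st, out, h1, h2, h3⟩ := ih
      rw [Function.iterate_succ_apply', h1]
      cases st with
      | nil => exact ⟨.nil, out, by simp [dfsStep], h2, by rw [Nat.add_mul]; omega⟩
      | cons y st =>
        refine ⟨(kids y).append st, .cons y out, by simp [dfsStep], ?_, ?_⟩
        · have := hk y
          simp [Data.total] at h2 this ⊢
          omega
        · simp [Data.total] at h2
          simp [Data.size, Nat.add_mul] at h3 ⊢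
          omega
  have hex : ∀ x : Data, ∃ i, ((dfsStep kids)^[i] (.cons (.cons x .nil) .nil)).hd = .nil :=
    fun x => ⟨_, hend x⟩
  have : PC fun _ x => ALCH.dfs kids x := by
    -- The program stops as soon as the stack is empty; the remaining iterations in the definition
    -- of `dfs` leave the state unchanged.
    have h := PC.loop (p := fun _ z => ¬ z.hd = .nil) (F := fun _ z => dfsStep kids z)
      (I := fun _ x => .cons (.cons x .nil) .nil) ((DP.eq PC.id.hd PC.nil).not) hstep
      ((PC.id.cons PC.nil).cons PC.nil) (fun _ x => Nat.find (hex x))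
      (1 + (1 + 2 * .X) + (1 + .X * (.X + 1)))
      (fun A x i hi => Nat.find_min (hex x) hi) (fun A x => not_not.2 (Nat.find_spec (hex x)))
      (fun A x => ?_) (fun A x i hi => ?_)
    · convert h.tl using 4 with A x
      rw [ALCH.dfs]
      congr 1
      obtain ⟨j, hj⟩ := Nat.exists_eq_add_of_le' (Nat.find_min' (hex x) (hend x))
      conv_lhs => rw [hj, Function.iterate_add_apply]
      exact hidle _ _ (Nat.find_spec (hex x))
    · have := Nat.find_min' (hex x) (hend x)
      simp only [Polynomial.eval_add, Polynomial.eval_mul,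
        Polynomial.eval_X, Polynomial.eval_ofNat, Polynomial.eval_one]
      omega
    · have h0 := Nat.find_min' (hex x) (hend x)
      obtain ⟨st, out, h1, h2, h3⟩ := hsize x i
      have h4 : i * (x.size + 1) ≤ x.size * (x.size + 1) := Nat.mul_le_mul_right _ (by omega)
      have h5 : st.size ≤ 1 + 2 * st.total := by
        rw [Data.size_eq_sum, Data.total]
        have : ∀ l : List Data, (l.map fun a => 1 + a.size).sum ≤ 2 * (l.map Data.size).sum := by
          intro l
          induction l with
          | nil => simp
          | cons y l ih =>
            have := y.size_pos
            simp only [List.map_cons, List.sum_cons]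
            omega
        have := this st.toList
        omega
      rw [h1]
      simp only [Data.size, Polynomial.eval_add, Polynomial.eval_mul,
        Polynomial.eval_X, Polynomial.eval_ofNat, Polynomial.eval_one]
      omega
  exact this.comp hF

/-! ### Sublists -/

/-- All sublists of a list. -/
def Data.subs (a : Data) : Data :=
  a.toList.foldl (fun acc y => acc.append (acc.map (.cons y))) (.cons .nil .nil)

theorem mem_of_mem_subs {a U x : Data} (hU : U ∈ a.subs.toList) (hx : x ∈ U.toList) :
    x ∈ a.toList := by
  have : ∀ (l : List Data) (b : Data),
      U ∈ (l.foldl (fun acc y => acc.append (acc.map (.cons y))) b).toList →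
      ∃ V ∈ b.toList, ∀ x ∈ U.toList, x ∈ V.toList ∨ x ∈ l := by
    intro l
    induction l with
    | nil => intro b h; exact ⟨U, h, fun x => Or.inl⟩
    | cons y l ih =>
      intro b h
      obtain ⟨V, hV, h2⟩ := ih _ h
      simp only [Data.toList_append, Data.toList_map, List.mem_append, List.mem_map] at hV
      rcases hV with hV | ⟨W, hW, rfl⟩
      · exact ⟨V, hV, fun x hx => (h2 x hx).imp_right (by simp +contextual)⟩
      · refine ⟨W, hW, fun x hx => ?_⟩
        have := h2 x hx
        simp at this ⊢
        tauto
  obtain ⟨V, hV, h⟩ := this _ _ hU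
  simp at hV
  subst hV
  simpa using h x hx

theorem exists_mem_subs (a : Data) (p : Data → Prop) :
    ∃ U ∈ a.subs.toList, ∀ x, x ∈ U.toList ↔ x ∈ a.toList ∧ p x := by
  have : ∀ (l : List Data) (b V : Data), V ∈ b.toList →
      ∃ U ∈ (l.foldl (fun acc y => acc.append (acc.map (.cons y))) b).toList,
        ∀ x, x ∈ U.toList ↔ x ∈ V.toList ∨ (x ∈ l ∧ p x) := by
    intro l
    induction l with
    | nil => intro b V hV; exact ⟨V, hV, by simp⟩
    | cons y l ih =>
      intro b V hV
      by_cases hy : p y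
      · obtain ⟨U, hU, h⟩ := ih (b.append (b.map (.cons y))) (.cons y V) (by simp [hV])
        refine ⟨U, hU, fun x => ?_⟩
        rw [h]
        by_cases hx : x = y
        · subst hx; simp [hy]
        · simp [hx]
      · obtain ⟨U, hU, h⟩ := ih (b.append (b.map (.cons y))) V (by simp [hV])
        refine ⟨U, hU, fun x => ?_⟩
        rw [h]
        by_cases hx : x = y
        · subst hx; simp [hy]
        · simp [hx]
  obtain ⟨U, hU, h⟩ := this a.toList (.cons .nil .nil) .nil (by simp)
  exact ⟨U, hU, by simpa using h⟩

/-- Each `y` adds a second copy of the list with `y` in front of every member, which multiplies the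
size by at most `y.size + 3`. -/
theorem size_subs_le (l : List Data) (b : Data) :
    (l.foldl (fun acc y => acc.append (acc.map (.cons y))) b).size ≤
      b.size * 2 ^ (2 * (encList l).size) := by
  induction l generalizing b with
  | nil => exact Nat.le_mul_of_pos_right _ (by positivity)
  | cons y l ih =>
    refine (ih _).trans ?_
    have h1 := Data.size_append b (b.map (.cons y))
    have h2 : (b.map (.cons y)).size ≤ b.size * (y.size + 2) := by
      rw [Data.map, size_encList, b.size_eq_sum]
      induction b.toList with
      | nil => simp
      | cons z l ih =>
        simp [Data.size, Nat.add_mul] at ih ⊢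
        nlinarith
    have h3 : y.size < 2 ^ y.size := Nat.lt_two_pow_self
    have h5 := y.size_pos
    have h4 : (b.append (b.map (.cons y))).size ≤ b.size * 2 ^ (2 * (1 + y.size)) := by
      calc (b.append (b.map (.cons y))).size ≤ b.size * (y.size + 3) := by
            rw [Nat.mul_add] at h2 ⊢; omega
        _ ≤ b.size * 2 ^ (2 * (1 + y.size)) := by
            apply Nat.mul_le_mul_left
            have : 2 ^ y.size ≤ 2 ^ (2 * y.size) := Nat.pow_le_pow_right (by omega) (by omega)
            rw [Nat.mul_add, Nat.pow_add]
            omega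
    calc _ ≤ b.size * 2 ^ (2 * (1 + y.size)) * 2 ^ (2 * (encList l).size) :=
          Nat.mul_le_mul_right _ h4
      _ = b.size * 2 ^ (2 * (encList (y :: l)).size) := by
          rw [mul_assoc, ← pow_add]; simp only [encList, Data.size]; ring_nf

/-- Adding the list of all sublists of its head to a tree takes exponential time. -/
theorem RunsIn.subs : ∃ q : Polynomial ℕ,
    RunsIn (fun _ x => .cons x.hd.subs x) fun n => q.eval (2 ^ (2 * n + 2) + 2 * n + 1) := by
  have hf : PC fun _ z => .cons (z.hd.tl.hd.append (z.hd.tl.hd.map (.cons z.tl))) z.hd.hd :=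
    (PC.id.hd.tl.hd.append (PC.map (f := fun _ x y => .cons x.tl y) PC.id.hd.tl.hd
      (PC.id.hd.tl.cons PC.id.tl))).cons PC.id.hd.hd
  obtain ⟨q, hq⟩ := RunsIn.foldl
    (f := fun _ x acc y => .cons (acc.hd.append (acc.hd.map (.cons y))) x) hf PC.id.hd
    ((PC.const (.cons .nil .nil)).cons PC.id)
  have key : ∀ (l : List Data) (b x : Data),
      l.foldl (fun (acc y : Data) => Data.cons (acc.hd.append (acc.hd.map (.cons y))) x)
        (.cons b x) = .cons (l.foldl (fun acc y => acc.append (acc.map (.cons y))) b) x := by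
    intro l
    induction l with
    | nil => simp
    | cons y l ih => intro b x; simp [ih]
  refine ⟨q, ?_⟩
  convert hq (fun n => 2 ^ (2 * n + 2) + n + 1) ?_ using 3 with A x n
  · rw [key]; rfl
  · ring
  · intro A x l' hl'
    rw [key]
    have h1 := size_subs_le l' (.cons .nil .nil)
    have h2 := size_encList_le_of_prefix hl'
    rw [encList_toList] at h2
    have h3 : 2 ^ (2 * (encList l').size) ≤ 2 ^ (2 * x.size) :=
      Nat.pow_le_pow_right (by omega) (by have := x.size_hd_le; omega)
    simp only [Data.size] at h1 ⊢
    rw [Nat.pow_add]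
    omega

/-! ### The algorithm

A context is `cons Sub (cons Cl a)`, where `a` is the input, `Cl` lists its subtrees and `Sub` lists
the sublists of `Cl`. A full context is `cons Mos (cons Types w)`, where `w` is a context, `Types`
lists types, which are members of `Sub`, and `Mos` lists mosaics, which are sublists of `Types`. -/

/-- The two immediate subtrees of a tree. -/
noncomputable def kidsAll (x : Data) : Data :=
  if x = .nil then .nil else .cons x.hd (.cons x.tl .nil)

/-- The arguments of a term. -/
noncomputable def kidsTerm (x : Data) : Data :=
  if x.hd = encUnary 2 then .cons x.tl .nil
  else if x.hd = encUnary 3 then .cons x.tl.hd (.cons x.tl.tl .nil)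
  else if x.hd = encUnary 4 then .cons x.tl.tl .nil
  else .nil

/-- Entailment of the role inclusion `r ⊑ s` by the ontology. -/
def rsub (w r s : Data) : Prop :=
  -- Reachability is expressed through all closed sets; these are already listed, so no iteration is
  -- needed.
  ∀ U ∈ w.hd.toList, r ∈ U.toList →
    (∀ i ∈ w.tl.tl.hd.toList, i.hd = encUnary 1 → i.tl.hd ∈ U.toList → i.tl.tl ∈ U.toList) →
      s ∈ U.toList

/-- An element of type `t` may have an `r`-successor of type `u`. -/
def succ (w r t u : Data) : Prop :=
  ∀ x ∈ w.tl.hd.toList, x.hd = encUnary 4 → rsub w r x.tl.hd → x.tl.tl ∈ u.toList → x ∈ t.toList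

/-- The set `t` respects the Boolean constructors and the concept inclusions. -/
def locOK (w t : Data) : Prop :=
  (∀ x ∈ w.tl.hd.toList, (x.hd = encUnary 0 → x ∈ t.toList) ∧
    (x.hd = encUnary 2 → (x ∈ t.toList ↔ ¬ x.tl ∈ t.toList)) ∧
    (x.hd = encUnary 3 → (x ∈ t.toList ↔ x.tl.hd ∈ t.toList ∧ x.tl.tl ∈ t.toList))) ∧
  ∀ i ∈ w.tl.tl.hd.toList, i.hd = encUnary 0 → i.tl.hd ∈ t.toList → i.tl.tl ∈ t.toList

/-- All existential restrictions in members of `U` have witnesses in `U`. -/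
def selfSupp (w U : Data) : Prop :=
  ∀ t ∈ U.toList, ∀ x ∈ t.toList, x.hd = encUnary 4 →
    ∃ u ∈ U.toList, x.tl.tl ∈ u.toList ∧ succ w x.tl.hd t u

/-- Restricts a full context to the satisfiable types. -/
noncomputable def restrictTypes (e : Data) : Data :=
  -- When `e.hd` lists all sets of types, this is the greatest fixed point of type elimination,
  -- found by search as the union of all self-supporting sets.
  .cons (e.tl.hd.filter fun t => ∃ U ∈ e.hd.toList, t ∈ U.toList ∧ selfSupp e.tl.tl U) e.tl.tl

/-- Restricts the mosaics of a full context to those made of satisfiable types. -/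
noncomputable def restrictMosaics (e : Data) : Data :=
  .cons (e.hd.filter fun T => ∀ t ∈ T.toList, t ∈ (restrictTypes e).hd.toList) (restrictTypes e)

noncomputable def sigAtoms (A : Set Data) (w : Data) : Data :=
  w.tl.hd.filter fun x => x.hd = encUnary 1 ∧ .cons (encUnary 0) x.tl ∈ A

noncomputable def sigRoles (A : Set Data) (w : Data) : Data :=
  w.tl.hd.filter fun s => .cons (encUnary 1) s ∈ A

/-- The term for `exactly the types in T are possible up to depth k`. -/
noncomputable def chi (e k T : Data) : Data :=
  (e.tl.hd.map fun u => if u ∈ T.toList then k.tMac u else (k.tMac u).tNeg).conj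

/-- A disjunction over the mosaics with a witness for `x`, written with negations. If no signature
role lies above the role of `x`, the inner conjunction is empty: such a witness is invisible from
the signature. -/
noncomputable def bodyEx (A : Set Data) (e k t x : Data) : Data :=
  ((e.hd.filter fun T => ∃ u ∈ T.toList, x.tl.tl ∈ u.toList ∧ succ e.tl.tl x.tl.hd t u).map
    fun T => (((sigRoles A e.tl.tl).filter fun s => rsub e.tl.tl x.tl.hd s).map
      fun s => s.tEx (chi e k T)).conj.tNeg).conj.tNeg

/-- Rules out signature successors without a type compatible with `t`. This clause yields the
compatibility between neighbouring mosaics in `survives_of_exactly`. -/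
noncomputable def bodyAll (e k t s : Data) : Data :=
  (s.tEx ((e.hd.filter fun T => ∀ u ∈ T.toList, ¬ succ e.tl.tl s t u).map
    fun T => (chi e k T).tNeg).conj.tNeg).tNeg

/-- The term for `t is possible up to depth k + 1`. -/
noncomputable def body (A : Set Data) (e k t : Data) : Data :=
  (((sigAtoms A e.tl.tl).map fun x => if x ∈ t.toList then x else x.tNeg).append
    (((t.filter fun x => x.hd = encUnary 4).map (bodyEx A e k t)).append
      ((sigRoles A e.tl.tl).map (bodyAll e k t)))).conj

/-- The term for the interpolant. -/
noncomputable def goalTerm (e : Data) : Data :=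
  ((e.tl.hd.filter fun t => e.tl.tl.tl.tl.tl.hd ∈ t.toList).map
    fun t => (e.hd.len.tMac t).tNeg).conj.tNeg

/-- Placeholders of depth `0` stand for `⊤` and need no body. Every later one follows the subterms
of its body, whose placeholders have the previous depth. -/
noncomputable def levelKeys (A : Set Data) (e k : Data) : Data :=
  e.tl.hd.bind fun t => (if k = .nil then .nil else dfs kidsTerm (body A e k.tl t)).append
    (.cons (k.tMac t) .nil)

/-- All terms that become nodes of the DAG, in topological order. -/
noncomputable def keys (A : Set Data) (e : Data) : Data :=
  (e.hd.levels.bind (levelKeys A e)).append (dfs kidsTerm (goalTerm e))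

/-- The node of a term, where `K` lists all terms that become nodes. -/
noncomputable def nodeData (A : Set Data) (e K x : Data) : Data :=
  if x.hd = encUnary 1 then
    if .cons (encUnary 0) x.tl ∈ A then x else .cons (encUnary 0) .nil
  else if x.hd = encUnary 2 then .cons (encUnary 2) (K.idx x.tl)
  else if x.hd = encUnary 3 then .cons (encUnary 3) (.cons (K.idx x.tl.hd) (K.idx x.tl.tl))
  else if x.hd = encUnary 4 then
    if .cons (encUnary 1) x.tl.hd ∈ A then
      .cons (encUnary 4) (.cons x.tl.hd (K.idx x.tl.tl))
    else .cons (encUnary 0) .nil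
  else if x.hd = encUnary 5 then
    if x.tl.hd = .nil then .cons (encUnary 0) .nil
    else .cons (encUnary 3) (.cons (K.idx (body A e x.tl.hd.tl x.tl.tl))
      (K.idx (body A e x.tl.hd.tl x.tl.tl)))
  else .cons (encUnary 0) .nil

noncomputable def output (A : Set Data) (e : Data) : Data :=
  .cons ((keys A e).idx (goalTerm e)) ((keys A e).map (nodeData A e (keys A e)))

/-! ### Its running time -/

theorem total_kidsAll_lt (x : Data) : (kidsAll x).total < x.size := by
  cases x <;> simp [kidsAll, Data.total, Data.size]

theorem total_kidsTerm_lt (x : Data) : (kidsTerm x).total < x.size := by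
  cases x with
  | nil => simp [kidsTerm, encUnary, encList, Data.total, Data.size]
  | cons tag p =>
    have h1 := p.size_tl_le
    have h2 : p.hd.size + p.tl.size ≤ p.size + 1 := by
      cases p <;> simp [Data.size]; omega
    by_cases k1 : tag = encUnary 2
    · simp [kidsTerm, k1, Data.total, Data.size, size_encUnary]
    by_cases k2 : tag = encUnary 3
    · simp [kidsTerm, k2, Data.total, Data.size, size_encUnary]
      split <;> simp
      omega
    by_cases k3 : tag = encUnary 4
    · simp [kidsTerm, k3, Data.total, Data.size, size_encUnary]
      repeat' split
      all_goals simp <;> omega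
    · simp [kidsTerm, k1, k2, k3, Data.total, Data.size]

theorem PC.kidsAll : PC fun _ x => kidsAll x :=
  PC.ite (DP.eq PC.id PC.nil) PC.nil (PC.id.hd.cons (PC.id.tl.cons PC.nil))

theorem PC.kidsTerm : PC fun _ x => kidsTerm x :=
  PC.ite (DP.eq PC.id.hd (PC.const _)) (PC.id.tl.cons PC.nil) <|
  PC.ite (DP.eq PC.id.hd (PC.const _)) (PC.id.tl.hd.cons (PC.id.tl.tl.cons PC.nil)) <|
  PC.ite (DP.eq PC.id.hd (PC.const _)) (PC.id.tl.tl.cons PC.nil) PC.nil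

section
variable {e k r s t u w x : Set Data → Data → Data}

/-- The definitions of the algorithm use only quantifiers, maps and filters over lists at hand, so
the polynomial-time closure rules apply along their structure once the arguments are packed into one
tree. The same holds for the lemmas that follow. -/
theorem DP.rsub (hw : PC w) (hr : PC r) (hs : PC s) :
    DP fun A z => rsub (w A z) (r A z) (s A z) := by
  have : DP fun _ z => ALCH.rsub z.hd z.tl.hd z.tl.tl := by
    unfold ALCH.rsub
    repeat' with_reducible
      first
        | exact PC.id | apply PC.const | apply DP.forall_mem | apply DP.mem | apply DP.eq
        | apply DP.imp | apply PC.hd | apply PC.tl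
  exact PC.comp this (hw.cons (hr.cons hs))

theorem DP.succ (hw : PC w) (hr : PC r) (ht : PC t) (hu : PC u) :
    DP fun A z => succ (w A z) (r A z) (t A z) (u A z) := by
  have : DP fun _ z => ALCH.succ z.hd z.tl.hd z.tl.tl.hd z.tl.tl.tl := by
    unfold ALCH.succ
    repeat' with_reducible
      first
        | exact PC.id | apply PC.const | apply DP.rsub | apply DP.forall_mem | apply DP.mem
        | apply DP.eq | apply DP.imp | apply PC.hd | apply PC.tl
  exact PC.comp this (hw.cons (hr.cons (ht.cons hu)))

theorem DP.locOK : DP fun _ z => locOK z.hd z.tl := by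
  unfold ALCH.locOK
  repeat' with_reducible
    first
      | exact PC.id | apply PC.const | apply DP.and | apply DP.forall_mem | apply DP.mem
      | apply DP.eq | apply DP.iff | apply DP.not | apply DP.imp | apply PC.hd | apply PC.tl

theorem DP.selfSupp (hw : PC w) (hu : PC u) : DP fun A z => selfSupp (w A z) (u A z) := by
  have : DP fun _ z => ALCH.selfSupp z.hd z.tl := by
    unfold ALCH.selfSupp
    repeat' with_reducible
      first
        | exact PC.id | apply PC.const | apply DP.succ | apply DP.forall_mem
        | apply DP.exists_mem | apply DP.and | apply DP.mem | apply DP.eq | apply DP.imp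
        | apply PC.hd | apply PC.tl
  exact PC.comp this (hw.cons hu)

theorem PC.restrictTypes : PC fun _ e => restrictTypes e := by
  unfold ALCH.restrictTypes
  repeat' with_reducible
    first
      | exact PC.id | apply PC.const | apply PC.filter | apply DP.selfSupp | apply DP.exists_mem
      | apply DP.and | apply DP.mem | apply DP.eq | apply PC.hd | apply PC.tl | apply PC.cons

theorem PC.restrictMosaics : PC fun _ e => restrictMosaics e := by
  refine PC.cons (PC.filter PC.id.hd (DP.forall_mem PC.id.tl (DP.mem PC.id.tl ?_)))
    PC.restrictTypes
  exact PC.hd (PC.restrictTypes.comp PC.id.hd.hd)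

theorem PC.sigAtoms (hw : PC w) : PC fun A z => sigAtoms A (w A z) := by
  have : PC fun A z => ALCH.sigAtoms A z :=
    PC.filter PC.id.tl.hd ((DP.eq PC.id.tl.hd (PC.const _)).and
      (DP.query ((PC.const _).cons PC.id.tl.tl)))
  exact this.comp hw

theorem PC.sigRoles (hw : PC w) : PC fun A z => sigRoles A (w A z) := by
  have : PC fun A z => ALCH.sigRoles A z :=
    PC.filter PC.id.tl.hd (DP.query ((PC.const _).cons PC.id.tl))
  exact this.comp hw

theorem PC.chi (he : PC e) (hk : PC k) (ht : PC t) :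
    PC fun A z => chi (e A z) (k A z) (t A z) := by
  have : PC fun _ z => ALCH.chi z.hd z.tl.hd z.tl.tl := by
    unfold ALCH.chi
    repeat' with_reducible
      first
        | exact PC.id | apply PC.const | apply PC.conj | apply PC.map | apply PC.ite
        | apply PC.tNeg | apply PC.tMac | apply DP.mem | apply PC.hd | apply PC.tl
  simpa only [Data.hd_cons, Data.tl_cons] using this.comp (he.cons (hk.cons ht))

theorem PC.bodyEx (he : PC e) (hk : PC k) (ht : PC t) (hx : PC x) :
    PC fun A z => bodyEx A (e A z) (k A z) (t A z) (x A z) := by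
  have : PC fun A z => ALCH.bodyEx A z.hd z.tl.hd z.tl.tl.hd z.tl.tl.tl := by
    unfold ALCH.bodyEx
    repeat' with_reducible
      first
        | exact PC.id | apply PC.const | apply PC.conj | apply PC.map | apply PC.filter
        | apply PC.sigRoles | apply DP.rsub | apply DP.succ | apply PC.chi | apply PC.tEx
        | apply PC.tNeg | apply PC.tMac | apply DP.exists_mem | apply DP.and | apply DP.mem
        | apply PC.hd | apply PC.tl
  simpa only [Data.hd_cons, Data.tl_cons] using this.comp (he.cons (hk.cons (ht.cons hx)))

theorem PC.bodyAll (he : PC e) (hk : PC k) (ht : PC t) (hs : PC s) :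
    PC fun A z => bodyAll (e A z) (k A z) (t A z) (s A z) := by
  have : PC fun _ z => ALCH.bodyAll z.hd z.tl.hd z.tl.tl.hd z.tl.tl.tl := by
    unfold ALCH.bodyAll
    repeat' with_reducible
      first
        | exact PC.id | apply PC.const | apply PC.conj | apply PC.map | apply PC.filter
        | apply DP.succ | apply PC.chi | apply PC.tEx | apply PC.tNeg | apply PC.tMac
        | apply DP.forall_mem | apply DP.not | apply DP.mem | apply PC.hd | apply PC.tl
  simpa only [Data.hd_cons, Data.tl_cons] using this.comp (he.cons (hk.cons (ht.cons hs)))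

theorem PC.body (he : PC e) (hk : PC k) (ht : PC t) :
    PC fun A z => body A (e A z) (k A z) (t A z) := by
  have : PC fun A z => ALCH.body A z.hd z.tl.hd z.tl.tl := by
    unfold ALCH.body
    repeat' with_reducible
      first
        | exact PC.id | apply PC.const | apply PC.conj | apply PC.map | apply PC.filter
        | apply PC.sigRoles | apply PC.sigAtoms | apply PC.bodyEx | apply PC.bodyAll
        | apply PC.append | apply PC.ite | apply PC.tNeg | apply DP.mem | apply DP.eq | apply PC.hd
        | apply PC.tl
  simpa only [Data.hd_cons, Data.tl_cons] using this.comp (he.cons (hk.cons ht))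

theorem PC.goalTerm (he : PC e) : PC fun A z => goalTerm (e A z) := by
  have : PC fun _ z => ALCH.goalTerm z := by
    unfold ALCH.goalTerm
    repeat' with_reducible
      first
        | exact PC.id | apply PC.const | apply PC.conj | apply PC.map | apply PC.filter
        | apply PC.tNeg | apply PC.tMac | apply PC.len | apply DP.mem | apply PC.hd | apply PC.tl
  exact this.comp he

theorem PC.levelKeys (he : PC e) (hk : PC k) : PC fun A z => levelKeys A (e A z) (k A z) := by
  have : PC fun A z => ALCH.levelKeys A z.hd z.tl := by
    unfold ALCH.levelKeys
    repeat' with_reducible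
      first
        | exact PC.id | apply PC.const | exact PC.kidsTerm | exact total_kidsTerm_lt
        | apply PC.bind | apply PC.append | apply PC.tMac | apply PC.body | apply PC.dfs
        | apply PC.ite | apply DP.eq | apply PC.hd | apply PC.tl | apply PC.cons
  simpa only [Data.hd_cons, Data.tl_cons] using this.comp (he.cons hk)

theorem PC.keys (he : PC e) : PC fun A z => keys A (e A z) := by
  have : PC fun A z => ALCH.keys A z :=
    (PC.bind PC.id.hd.levels (PC.levelKeys PC.id.hd PC.id.tl)).append
      (PC.dfs total_kidsTerm_lt PC.kidsTerm (PC.goalTerm PC.id))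
  exact this.comp he

theorem PC.nodeData (he : PC e) (hk : PC k) (hx : PC x) :
    PC fun A z => nodeData A (e A z) (k A z) (x A z) := by
  have : PC fun A z => ALCH.nodeData A z.hd z.tl.hd z.tl.tl := by
    unfold ALCH.nodeData
    repeat' with_reducible
      first
        | exact PC.id | apply PC.const | apply PC.ite | apply PC.idx | apply PC.body
        | apply DP.eq | apply DP.query | apply PC.hd | apply PC.tl | apply PC.cons
  simpa only [Data.hd_cons, Data.tl_cons] using this.comp (he.cons (hk.cons hx))

theorem PC.output : PC fun A e => output A e := by
  unfold ALCH.output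
  repeat' with_reducible
    first
      | exact PC.id | apply PC.idx | apply PC.keys | apply PC.goalTerm | apply PC.map
      | apply PC.nodeData | apply PC.hd | apply PC.tl | apply PC.cons

end

/-! ### Semantics of terms -/

theorem encName_injective : Function.Injective encName := by
  intro m n h
  have h1 := congrArg Data.toList h
  simp only [encName, toList_encList] at h1
  have h2 : Function.Injective encBit := by intro a b; cases a <;> cases b <;> simp [encBit]
  have h3 := List.map_injective_iff.2 h2 h1
  have h4 : ∀ n : ℕ, Nat.ofDigits 2 (n.bits.map fun b : Bool => cond b 1 0) = n := fun n => by
    rw [← Nat.digits_two_eq_bits, Nat.ofDigits_digits]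
  rw [← h4 m, ← h4 n, h3]

theorem encUnary_injective : Function.Injective encUnary := by
  intro m n h
  have := congrArg Data.size h
  simp only [size_encUnary] at this
  omega

@[simp] theorem encUnary_inj {m n : ℕ} : encUnary m = encUnary n ↔ m = n :=
  encUnary_injective.eq_iff

/-- A tree that codes no name gets the empty extension. Subtrees of the input that only look like
terms thereby have a meaning too and need no special treatment. -/
def dConc (I : Interpretation) (p : Data) (d : I.Dom) : Prop :=
  ∃ n, p = encName n ∧ d ∈ I.concept n

def dRole (I : Interpretation) (p : Data) (d d' : I.Dom) : Prop :=
  ∃ n, p = encName n ∧ (d, d') ∈ I.role n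

@[simp] theorem dConc_encName {I : Interpretation} {n : ℕ} {d : I.Dom} :
    dConc I (encName n) d ↔ d ∈ I.concept n := by
  constructor
  · rintro ⟨m, h, h'⟩; rwa [encName_injective h]
  · exact fun h => ⟨n, rfl, h⟩

@[simp] theorem dRole_encName {I : Interpretation} {n : ℕ} {d d' : I.Dom} :
    dRole I (encName n) d d' ↔ (d, d') ∈ I.role n := by
  constructor
  · rintro ⟨m, h, h'⟩; rwa [encName_injective h]
  · exact fun h => ⟨n, rfl, h⟩

theorem size_tl_lt_of_hd {x : Data} {n : ℕ} (h : x.hd = encUnary (n + 1)) : x.tl.size < x.size := by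
  cases x with
  | nil => exact absurd (congrArg Data.size h) (by simp [size_encUnary, Data.size])
  | cons a b => simp [Data.size]

/-- The extension of a term, where `mac` interprets the placeholders. Trees that are not terms are
interpreted in some way. -/
def holds (I : Interpretation) (mac : Data → I.Dom → Prop) (x : Data) (d : I.Dom) : Prop :=
  if x.hd = encUnary 0 then True
  else if x.hd = encUnary 1 then dConc I x.tl d
  else if _h : x.hd = encUnary 2 then ¬ holds I mac x.tl d
  else if _h : x.hd = encUnary 3 then holds I mac x.tl.hd d ∧ holds I mac x.tl.tl d
  else if _h : x.hd = encUnary 4 then ∃ d', dRole I x.tl.hd d d' ∧ holds I mac x.tl.tl d'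
  else if x.hd = encUnary 5 then mac x.tl d
  else False
termination_by x.size
decreasing_by
  · exact size_tl_lt_of_hd _h
  · exact (x.tl.size_hd_le).trans_lt (size_tl_lt_of_hd _h)
  · exact (x.tl.size_tl_le).trans_lt (size_tl_lt_of_hd _h)
  · exact (x.tl.size_tl_le).trans_lt (size_tl_lt_of_hd _h)

section
variable {I : Interpretation} {mac : Data → I.Dom → Prop} {x : Data} {d : I.Dom}

theorem holds_of_top (h : x.hd = encUnary 0) : holds I mac x d := by
  rw [holds]; simp [h]

theorem holds_of_atom (h : x.hd = encUnary 1) : holds I mac x d ↔ dConc I x.tl d := by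
  rw [holds]; simp [h]

theorem holds_of_neg (h : x.hd = encUnary 2) : holds I mac x d ↔ ¬ holds I mac x.tl d := by
  rw [holds]; simp [h]

theorem holds_of_inf (h : x.hd = encUnary 3) :
    holds I mac x d ↔ holds I mac x.tl.hd d ∧ holds I mac x.tl.tl d := by
  rw [holds]; simp [h]

theorem holds_of_ex (h : x.hd = encUnary 4) :
    holds I mac x d ↔ ∃ d', dRole I x.tl.hd d d' ∧ holds I mac x.tl.tl d' := by
  rw [holds]; simp [h]

theorem holds_of_mac (h : x.hd = encUnary 5) : holds I mac x d ↔ mac x.tl d := by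
  rw [holds]; simp [h]

theorem holds_encode (C : Concept) : holds I mac C.encode d ↔ d ∈ C.ext I := by
  induction C generalizing d with
  | top => simp [Concept.ext, holds_of_top (x := Concept.top.encode) rfl]
  | atom n => rw [holds_of_atom rfl]; exact dConc_encName
  | neg C ih => rw [holds_of_neg rfl]; exact not_congr ih
  | inf C D ihC ihD => rw [holds_of_inf rfl]; exact and_congr ihC ihD
  | ex r C ih =>
    rw [holds_of_ex rfl]
    exact exists_congr fun d' => and_congr dRole_encName ih

end

/-! ### Contexts -/

/-- Closure under subtrees keeps the arguments of terms inside the closure; the last field says that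
every subset of the closure is listed. -/
structure IsContext (w : Data) : Prop where
  input_mem : w.tl.tl ∈ w.tl.hd.toList
  hd_mem : ∀ x ∈ w.tl.hd.toList, x.hd ∈ w.tl.hd.toList
  tl_mem : ∀ x ∈ w.tl.hd.toList, x.tl ∈ w.tl.hd.toList
  mem_of_sub : ∀ U ∈ w.hd.toList, ∀ x ∈ U.toList, x ∈ w.tl.hd.toList
  exists_sub : ∀ p : Data → Prop, ∃ U ∈ w.hd.toList, ∀ x, x ∈ U.toList ↔ x ∈ w.tl.hd.toList ∧ p x

/-- By `supp` and `complete`, the types form the greatest self-supporting family of locally coherent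
sets; every subset of them is a mosaic. -/
structure IsFullContext (e : Data) : Prop where
  ctx : IsContext e.tl.tl
  types : ∀ t ∈ e.tl.hd.toList, t ∈ e.tl.tl.hd.toList ∧ locOK e.tl.tl t
  supp : selfSupp e.tl.tl e.tl.hd
  complete : ∀ p : Data → Prop, (∀ t, p t → t ∈ e.tl.tl.hd.toList ∧ locOK e.tl.tl t) →
    (∀ t, p t → ∀ x ∈ t.toList, x.hd = encUnary 4 →
      ∃ u, p u ∧ x.tl.tl ∈ u.toList ∧ succ e.tl.tl x.tl.hd t u) → ∀ t, p t → t ∈ e.tl.hd.toList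
  mem_of_mos : ∀ T ∈ e.hd.toList, ∀ u ∈ T.toList, u ∈ e.tl.hd.toList
  exists_mos : ∀ p : Data → Prop, ∃ T ∈ e.hd.toList, ∀ u, u ∈ T.toList ↔ u ∈ e.tl.hd.toList ∧ p u

theorem IsContext.of_dfs (a : Data) :
    IsContext (.cons (dfs kidsAll a).subs (.cons (dfs kidsAll a) a)) := by
  obtain ⟨h1, h2, -⟩ := dfs_spec kidsAll total_kidsAll_lt a
  have h3 : ∀ x ∈ (dfs kidsAll a).toList, ∀ y ∈ (kidsAll x).toList, y ∈ (dfs kidsAll a).toList := by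
    intro x hx y hy
    obtain ⟨P, R, h⟩ := List.append_of_mem hx
    rw [h]
    exact List.mem_append_left _ (h2 P x R h y hy)
  refine ⟨h1, fun x hx => ?_, fun x hx => ?_, fun U hU x hx => mem_of_mem_subs hU hx,
    fun p => exists_mem_subs _ p⟩
  · cases x with
    | nil => exact hx
    | cons y z => exact h3 _ hx _ (by simp [kidsAll])
  · cases x with
    | nil => exact hx
    | cons y z => exact h3 _ hx _ (by simp [kidsAll])

/-- A union of self-supporting sets is self-supporting, which gives `supp`. Conversely, a
self-supporting family `p` of coherent sets is one of the enumerated sublists, which gives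
`complete`. -/
theorem IsContext.fullContext {w : Data} (hw : IsContext w) :
    IsFullContext (restrictMosaics
      (.cons (w.hd.filter (locOK w)).subs (.cons (w.hd.filter (locOK w)) w))) := by
  set e := Data.cons (w.hd.filter (locOK w)).subs (.cons (w.hd.filter (locOK w)) w) with he
  have h0 : ∀ t, t ∈ (restrictTypes e).hd.toList ↔ (t ∈ w.hd.toList ∧ locOK w t) ∧
      ∃ U ∈ e.hd.toList, t ∈ U.toList ∧ selfSupp w U := by
    intro t; simp [restrictTypes, he]; tauto
  refine ⟨hw, fun t ht => ((h0 t).1 ht).1, fun t ht x hx hxe => ?_, fun p hp hs t ht => ?_,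
    fun T hT u hu => ?_, fun p => ?_⟩
  · obtain ⟨-, U, hU, htU, hUs⟩ := (h0 t).1 ht
    obtain ⟨u, hu, h⟩ := hUs t htU x hx hxe
    refine ⟨u, (h0 u).2 ⟨?_, U, hU, hu, hUs⟩, h⟩
    simpa using mem_of_mem_subs hU hu
  · obtain ⟨U, hU, h⟩ := exists_mem_subs (w.hd.filter (locOK w)) p
    have h' : ∀ t, p t → t ∈ U.toList := fun t ht => (h t).2 ⟨by
      simpa using (show t ∈ w.hd.toList ∧ locOK w t from hp t ht), ht⟩
    refine (h0 t).2 ⟨hp t ht, U, hU, h' t ht, fun t ht x hx hxe => ?_⟩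
    obtain ⟨u, hu, h⟩ := hs t ((h t).1 ht).2 x hx hxe
    exact ⟨u, h' u hu, h⟩
  · simp only [restrictMosaics, Data.hd_cons, Data.toList_filter, List.mem_filter,
      decide_eq_true_eq] at hT
    exact hT.2 u hu
  · obtain ⟨T, hT, h⟩ := exists_mem_subs (w.hd.filter (locOK w))
      fun u => u ∈ (restrictTypes e).hd.toList ∧ p u
    refine ⟨T, ?_, fun u => ?_⟩
    · simp only [restrictMosaics, Data.hd_cons, Data.toList_filter, List.mem_filter,
        decide_eq_true_eq]
      exact ⟨hT, fun t ht => ((h t).1 ht).2.1⟩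
    · rw [h]
      refine ⟨fun h => h.2, fun h => ⟨?_, h⟩⟩
      simpa using ((h0 u).1 h.1).1

/-! ### Entailed role inclusions -/

section
variable {w : Data}

theorem rsub_refl (r : Data) : rsub w r r := fun _ _ h _ => h

theorem rsub_trans {r s s' : Data} (h : rsub w r s) (h' : rsub w s s') : rsub w r s' :=
  fun U hU hr hi => h' U hU (h U hU hr hi) hi

theorem succ_of_rsub {r s t u : Data} (h : succ w r t u) (hrs : rsub w r s) : succ w s t u :=
  fun x hx hxe hs hu => h x hx hxe (rsub_trans hrs hs) hu

theorem IsContext.mem_of_mem_toList (hw : IsContext w) {x y : Data} (hx : x ∈ w.tl.hd.toList)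
    (hy : y ∈ x.toList) : y ∈ w.tl.hd.toList := by
  induction x with
  | nil => simp at hy
  | cons a b _ ih =>
    simp only [Data.toList_cons, List.mem_cons] at hy
    rcases hy with rfl | hy
    · exact hw.hd_mem _ hx
    · exact ih (hw.tl_mem _ hx) hy

/-- The whole closure is itself a set closed under the role inclusions of the input. -/
theorem IsContext.mem_of_rsub (hw : IsContext w) {r s : Data} (hr : r ∈ w.tl.hd.toList)
    (h : rsub w r s) : s ∈ w.tl.hd.toList := by
  obtain ⟨U, hU, hU'⟩ := hw.exists_sub fun _ => True
  simp only [and_true] at hU'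
  rw [← hU']
  refine h U hU ((hU' r).2 hr) fun i hi _ _ => (hU' _).2 ?_
  exact hw.tl_mem _ (hw.tl_mem _ (hw.mem_of_mem_toList (hw.hd_mem _ hw.input_mem) hi))

end

/-! ### Types of elements of models -/

section
variable {O : Ontology} {C D : Concept} {w : Data} {I : Interpretation}

/-- `t` is the type of `d`. -/
def Represents (I : Interpretation) (w : Data) (d : I.Dom) (t : Data) : Prop :=
  t ∈ w.hd.toList ∧ ∀ x, x ∈ t.toList ↔ x ∈ w.tl.hd.toList ∧ holds I (fun _ _ => False) x d

theorem IsContext.exists_represents (hw : IsContext w) (d : I.Dom) : ∃ t, Represents I w d t :=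
  hw.exists_sub _

theorem IsContext.dRole_of_rsub (hw : IsContext w) (ha : w.tl.tl = encInput O C D)
    (hI : I.IsModel O) {r s : Data} {d d' : I.Dom} (hr : r ∈ w.tl.hd.toList) (hrs : rsub w r s)
    (h : dRole I r d d') : dRole I s d d' := by
  -- In a model, the roles containing the role of `r` are closed under the role inclusions, so they
  -- form a set to which `rsub` applies.
  obtain ⟨U, hU, hU'⟩ := hw.exists_sub fun s => ∀ d d', dRole I r d d' → dRole I s d d'
  refine ((hU' s).1 (hrs U hU ((hU' r).2 ⟨hr, fun _ _ h => h⟩) fun i hi hi1 hr' => ?_)).2 d d' h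
  refine (hU' _).2 ⟨?_, fun d d' h => ?_⟩
  · exact hw.tl_mem _ (hw.tl_mem _ (hw.mem_of_mem_toList (hw.hd_mem _ hw.input_mem) hi))
  · have h1 := ((hU' _).1 hr').2 d d' h
    rw [ha] at hi
    simp only [encInput, Data.hd_cons, toList_encList, List.mem_map] at hi
    obtain ⟨α, hα, rfl⟩ := hi
    cases α with
    | concept C D => simp [Inclusion.encode] at hi1
    | role m n =>
      simp only [Inclusion.encode, Data.tl_cons, Data.hd_cons, dRole_encName] at h1 ⊢
      exact hI _ hα h1

theorem IsContext.succ_of_dRole (hw : IsContext w) (ha : w.tl.tl = encInput O C D)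
    (hI : I.IsModel O) {r t u : Data} {d d' : I.Dom} (hr : r ∈ w.tl.hd.toList)
    (ht : Represents I w d t) (hu : Represents I w d' u) (h : dRole I r d d') : succ w r t u := by
  intro x hx hxe hrs hxu
  refine (ht.2 x).2 ⟨hx, (holds_of_ex hxe).2 ⟨d', hw.dRole_of_rsub ha hI hr hrs h, ?_⟩⟩
  exact ((hu.2 _).1 hxu).2

theorem IsContext.locOK_of_represents (hw : IsContext w) (ha : w.tl.tl = encInput O C D)
    (hI : I.IsModel O) {t : Data} {d : I.Dom} (ht : Represents I w d t) : locOK w t := by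
  refine ⟨fun x hx => ⟨fun h => ?_, fun h => ?_, fun h => ?_⟩, fun i hi hi0 h => ?_⟩
  · exact (ht.2 x).2 ⟨hx, holds_of_top h⟩
  · have := hw.tl_mem x hx
    simp [ht.2, hx, holds_of_neg h, this]
  · have h1 := hw.tl_mem x hx
    have h2 := hw.tl_mem _ h1
    have h3 := hw.hd_mem _ h1
    simp [ht.2, hx, holds_of_inf h, h2, h3]
  · have h1 := hw.mem_of_mem_toList (hw.hd_mem _ hw.input_mem) hi
    refine (ht.2 _).2 ⟨hw.tl_mem _ (hw.tl_mem _ h1), ?_⟩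
    have h2 := ((ht.2 _).1 h).2
    rw [ha] at hi
    simp only [encInput, Data.hd_cons, toList_encList, List.mem_map] at hi
    obtain ⟨α, hα, rfl⟩ := hi
    cases α with
    | role m n => simp [Inclusion.encode] at hi0
    | concept C D =>
      simp only [Inclusion.encode, Data.tl_cons, Data.hd_cons, holds_encode] at h2 ⊢
      exact hI _ hα h2

/-- The types of all elements of one model support each other, so `complete` applies to this family.
-/
theorem IsFullContext.mem_types {e : Data} (he : IsFullContext e)
    (ha : e.tl.tl.tl.tl = encInput O C D) (hI : I.IsModel O) {t : Data} {d : I.Dom}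
    (ht : Represents I e.tl.tl d t) : t ∈ e.tl.hd.toList := by
  have hw := he.ctx
  refine he.complete (fun t => ∃ d : I.Dom, Represents I e.tl.tl d t) ?_ ?_ t ⟨d, ht⟩
  · rintro t ⟨d, ht⟩
    exact ⟨ht.1, hw.locOK_of_represents ha hI ht⟩
  · rintro t ⟨d, ht⟩ x hx hxe
    obtain ⟨hxc, hxd⟩ := (ht.2 x).1 hx
    obtain ⟨d', hr, hd'⟩ := (holds_of_ex hxe).1 hxd
    obtain ⟨u, hu⟩ := hw.exists_represents d'
    have h1 := hw.tl_mem _ hxc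
    exact ⟨u, ⟨d', hu⟩, (hu.2 _).2 ⟨hw.tl_mem _ h1, hd'⟩,
      hw.succ_of_dRole ha hI (hw.hd_mem _ h1) ht hu hr⟩

end

/-! ### Types that are possible up to some depth -/

/-- `T` lists exactly the types that `P` allows at `d`. -/
def Exactly (e : Data) {X : Type} (P : Data → X → Prop) (T : Data) (d : X) : Prop :=
  ∀ u ∈ e.tl.hd.toList, (u ∈ T.toList ↔ P u d)

/-- From the types possible up to some depth to the types possible up to the next depth. -/
def thetaStep (A : Set Data) (e : Data) (I : Interpretation) (P : Data → I.Dom → Prop)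
    (t : Data) (d : I.Dom) : Prop :=
  (∀ x ∈ (sigAtoms A e.tl.tl).toList, (x ∈ t.toList ↔ dConc I x.tl d)) ∧
  (∀ x ∈ t.toList, x.hd = encUnary 4 → ∃ T ∈ e.hd.toList,
    (∃ u ∈ T.toList, x.tl.tl ∈ u.toList ∧ succ e.tl.tl x.tl.hd t u) ∧
    ∀ s ∈ (sigRoles A e.tl.tl).toList, rsub e.tl.tl x.tl.hd s →
      ∃ d', dRole I s d d' ∧ Exactly e P T d') ∧
  ∀ s ∈ (sigRoles A e.tl.tl).toList, ∀ d', dRole I s d d' → ∀ T ∈ e.hd.toList,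
    Exactly e P T d' → ∃ u ∈ T.toList, succ e.tl.tl s t u

/-- `theta A e I n t d`: the type `t` is possible at `d` up to depth `n`. -/
def theta (A : Set Data) (e : Data) (I : Interpretation) : ℕ → Data → I.Dom → Prop
  | 0 => fun _ _ => True
  | n + 1 => thetaStep A e I (theta A e I n)

theorem mem_sigAtoms {A : Set Data} {w x : Data} : x ∈ (sigAtoms A w).toList ↔
    x ∈ w.tl.hd.toList ∧ x.hd = encUnary 1 ∧ .cons (encUnary 0) x.tl ∈ A := by
  simp [sigAtoms]

theorem mem_sigRoles {A : Set Data} {w s : Data} : s ∈ (sigRoles A w).toList ↔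
    s ∈ w.tl.hd.toList ∧ .cons (encUnary 1) s ∈ A := by
  simp [sigRoles]

/-- The mosaic to choose at a successor is the set of all types possible there, which contains the
successor's true type by induction. -/
theorem IsFullContext.theta_of_represents {e : Data} (he : IsFullContext e) {A : Set Data}
    {O : Ontology} {C D : Concept} {I : Interpretation} (ha : e.tl.tl.tl.tl = encInput O C D)
    (hI : I.IsModel O) (n : ℕ) {t : Data} {d : I.Dom} (ht : Represents I e.tl.tl d t) :
    theta A e I n t d := by
  have hw := he.ctx
  induction n generalizing t d with
  | zero => trivial
  | succ n ih =>
    refine ⟨fun x hx => ?_, fun x hx hxe => ?_, fun s hs d' hd' T hT hTd' => ?_⟩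
    · rw [mem_sigAtoms] at hx
      rw [ht.2, holds_of_atom hx.2.1]
      exact and_iff_right hx.1
    · obtain ⟨hxc, hxd⟩ := (ht.2 x).1 hx
      obtain ⟨d', hr, hd'⟩ := (holds_of_ex hxe).1 hxd
      obtain ⟨u, hu⟩ := hw.exists_represents d'
      obtain ⟨T, hT, hT'⟩ := he.exists_mos fun u => theta A e I n u d'
      have h1 := hw.tl_mem _ hxc
      refine ⟨T, hT, ⟨u, (hT' u).2 ⟨he.mem_types ha hI hu, ih hu⟩,
        (hu.2 _).2 ⟨hw.tl_mem _ h1, hd'⟩, hw.succ_of_dRole ha hI (hw.hd_mem _ h1) ht hu hr⟩,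
        fun s _ hrs => ⟨d', hw.dRole_of_rsub ha hI (hw.hd_mem _ h1) hrs hr, fun u hu => ?_⟩⟩
      rw [hT']
      exact and_iff_right hu
    · obtain ⟨u, hu⟩ := hw.exists_represents d'
      refine ⟨u, (hTd' u (he.mem_types ha hI hu)).2 (ih hu), ?_⟩
      exact hw.succ_of_dRole ha hI (mem_sigRoles.1 hs).1 ht hu hd'

/-! ### Mosaic elimination -/

/-- The mosaics that survive one round of elimination if `M` are the present ones. -/
def elimStep (A : Set Data) (e : Data) (M : Data → Prop) (T : Data) : Prop :=
  T ∈ e.hd.toList ∧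
  (∀ x ∈ (sigAtoms A e.tl.tl).toList, ∀ t ∈ T.toList, ∀ u ∈ T.toList,
    x ∈ t.toList → x ∈ u.toList) ∧
  ∀ t ∈ T.toList, ∀ x ∈ t.toList, x.hd = encUnary 4 → ∃ T', M T' ∧
    (∃ u ∈ T'.toList, x.tl.tl ∈ u.toList ∧ succ e.tl.tl x.tl.hd t u) ∧
    ∀ u ∈ T.toList, ∀ s ∈ (sigRoles A e.tl.tl).toList, rsub e.tl.tl x.tl.hd s →
      ∃ u' ∈ T'.toList, succ e.tl.tl s u u'

/-- The mosaics that survive `n` rounds of elimination. -/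
def survives (A : Set Data) (e : Data) : ℕ → Data → Prop
  | 0 => fun T => T ∈ e.hd.toList
  | n + 1 => elimStep A e (survives A e n)

section
variable {A : Set Data} {e : Data}

theorem elimStep_mono {M M' : Data → Prop} (h : ∀ T, M T → M' T) {T : Data}
    (hT : elimStep A e M T) : elimStep A e M' T := by
  refine ⟨hT.1, hT.2.1, fun t ht x hx hxe => ?_⟩
  obtain ⟨T', h1, h2⟩ := hT.2.2 t ht x hx hxe
  exact ⟨T', h T' h1, h2⟩

theorem mem_of_survives {n : ℕ} {T : Data} (h : survives A e n T) : T ∈ e.hd.toList := by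
  cases n with
  | zero => exact h
  | succ n => exact h.1

theorem survives_succ_le (n : ℕ) {T : Data} (h : survives A e (n + 1) T) : survives A e n T := by
  induction n generalizing T with
  | zero => exact h.1
  | succ n ih => exact elimStep_mono (fun _ => ih) h

/-- After as many rounds as there are mosaics, elimination is stable. -/
theorem survives_stable {T : Data} (h : survives A e e.hd.toList.length T) :
    survives A e (e.hd.toList.length + 1) T := by
  let S : ℕ → Finset Data := fun n => e.hd.toList.toFinset.filter (survives A e n)
  have hS : ∀ n T, T ∈ S n ↔ survives A e n T := fun n T => by
    simp only [S, Finset.mem_filter, List.mem_toFinset, and_iff_right_iff_imp]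
    exact mem_of_survives
  have hanti : ∀ n, S (n + 1) ⊆ S n := fun n T hT =>
    (hS _ _).2 (survives_succ_le n ((hS _ _).1 hT))
  have hconst : ∀ m n, S (m + 1) = S m → S (m + n + 1) = S (m + n) := by
    intro m n hm
    induction n with
    | zero => exact hm
    | succ n ih =>
      refine (hanti _).antisymm fun T hT => (hS _ _).2 ?_
      exact elimStep_mono (fun T' hT' => (hS _ _).1 (ih ▸ (hS _ _).2 hT')) ((hS _ _).1 hT)
  have hex : ∃ m ≤ e.hd.toList.length, S (m + 1) = S m := by
    by_contra hne
    push Not at hne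
    -- If every round removed a mosaic, there would be more rounds than mosaics.
    have : ∀ m ≤ e.hd.toList.length + 1, (S m).card + m ≤ e.hd.toList.length := by
      intro m
      induction m with
      | zero => exact fun _ => (Finset.card_filter_le _ _).trans (List.toFinset_card_le _)
      | succ m ih =>
        intro hm
        have h1 := ih (by omega)
        have h2 := Finset.card_lt_card ((hanti m).ssubset_of_ne (hne m (by omega)))
        omega
    have := this _ le_rfl
    omega
  obtain ⟨m, hm, hSm⟩ := hex
  obtain ⟨j, hj⟩ := Nat.exists_eq_add_of_le hm
  have := hconst m j hSm
  rw [← hj] at this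
  rw [← hS, this, hS]
  exact h

/-- A single type has nothing to agree with, and the singleton of a witness serves as the next
mosaic: compatibility along a role passes to the roles above it. -/
theorem IsFullContext.survives_singleton (he : IsFullContext e) (n : ℕ) {t : Data}
    (ht : t ∈ e.tl.hd.toList) : ∃ T, survives A e n T ∧ ∀ u, u ∈ T.toList ↔ u = t := by
  induction n generalizing t with
  | zero =>
    obtain ⟨T, hT, h⟩ := he.exists_mos fun u => u = t
    exact ⟨T, hT, fun u => by rw [h]; constructor <;> simp +contextual [ht]⟩
  | succ n ih =>
    obtain ⟨T, hT, h⟩ := he.exists_mos fun u => u = t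
    have hT' : ∀ u, u ∈ T.toList ↔ u = t := fun u => by rw [h]; constructor <;> simp +contextual [ht]
    refine ⟨T, ⟨hT, fun x _ u hu v hv => ?_, fun u hu x hx hxe => ?_⟩, hT'⟩
    · rw [(hT' u).1 hu, (hT' v).1 hv]; exact fun h => h
    · rw [(hT' u).1 hu] at hx ⊢
      obtain ⟨v, hv, hxv, hsucc⟩ := he.supp t ht x hx hxe
      obtain ⟨T₁, h1, h2⟩ := ih hv
      refine ⟨T₁, h1, ⟨v, (h2 v).2 rfl, hxv, hsucc⟩, fun u hu s _ hrs => ⟨v, (h2 v).2 rfl, ?_⟩⟩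
      rw [(hT' u).1 hu]
      exact succ_of_rsub hsucc hrs

/-- The set of all types possible at some element survives. -/
theorem IsFullContext.survives_of_exactly (he : IsFullContext e) {I : Interpretation} (n : ℕ)
    {T : Data} {d : I.Dom} (hT : T ∈ e.hd.toList) (h : Exactly e (theta A e I n) T d) :
    survives A e n T := by
  induction n generalizing T d with
  | zero => exact hT
  | succ n ih =>
    have hθ : ∀ t ∈ T.toList, theta A e I (n + 1) t d := fun t ht =>
      (h t (he.mem_of_mos T hT t ht)).1 ht
    refine ⟨hT, fun x hx t ht u hu hxt => ?_, fun t ht x hx hxe => ?_⟩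
    · exact ((hθ u hu).1 x hx).2 (((hθ t ht).1 x hx).1 hxt)
    · obtain ⟨T', hT', ⟨v, hv, hxv, hsucc⟩, hs⟩ := (hθ t ht).2.1 x hx hxe
      -- If a signature role lies above the role of `x`, the induction hypothesis applies at an
      -- element reached through it. Otherwise `T'` need not be realised anywhere, and the singleton
      -- of the witness replaces it, with no compatibility left to check.
      by_cases hne : ∃ s ∈ (sigRoles A e.tl.tl).toList, rsub e.tl.tl x.tl.hd s
      · obtain ⟨s, hs1, hs2⟩ := hne
        obtain ⟨d', -, hd'⟩ := hs s hs1 hs2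
        refine ⟨T', ih hT' hd', ⟨v, hv, hxv, hsucc⟩, fun u hu s hs1 hs2 => ?_⟩
        obtain ⟨d', hr, hd'⟩ := hs s hs1 hs2
        exact (hθ u hu).2.2 s hs1 d' hr T' hT' hd'
      · obtain ⟨T₁, h1, h2⟩ := he.survives_singleton n (he.mem_of_mos T' hT' v hv)
        exact ⟨T₁, h1, ⟨v, (h2 v).2 rfl, hxv, hsucc⟩, fun u _ s hs1 hs2 => absurd ⟨s, hs1, hs2⟩ hne⟩

/-! ### The model of surviving mosaics -/

/-- Every role of the signature above `r` may lead from each type in `T` to a type in `T'`. -/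
def link (A : Set Data) (e r T T' : Data) : Prop :=
  ∀ u ∈ T.toList, ∀ s ∈ (sigRoles A e.tl.tl).toList, rsub e.tl.tl r s →
    ∃ u' ∈ T'.toList, succ e.tl.tl s u u'

/-- An edge needs a role `r` of the closure that justifies it and lies below the given one, so that
role inclusions hold by transitivity. The `link` condition lets every other type of the source
mosaic follow the edge along signature roles. -/
def mosaicModel (A : Set Data) (e : Data) (n : ℕ) (T₀ t₀ : Data)
    (h : survives A e n T₀ ∧ t₀ ∈ T₀.toList) : Interpretation where
  Dom := {p : Data × Data // survives A e n p.1 ∧ p.2 ∈ p.1.toList}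
  nonempty := ⟨⟨(T₀, t₀), h⟩⟩
  concept m := {p | (Concept.atom m).encode ∈ p.1.2.toList}
  role m := {p | ∃ r ∈ e.tl.tl.tl.hd.toList, rsub e.tl.tl r (encName m) ∧
    succ e.tl.tl r p.1.1.2 p.2.1.2 ∧ link A e r p.1.1.1 p.2.1.1}

variable {T₀ t₀ : Data} {h₀ : survives A e e.hd.toList.length T₀ ∧ t₀ ∈ T₀.toList}

/-- The truth lemma: an edge into an element with the argument forces the restriction by `succ`, and
elimination supplies the witnesses. -/
theorem IsFullContext.mem_ext_mosaicModel (he : IsFullContext e) (C : Concept)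
    (hC : C.encode ∈ e.tl.tl.tl.hd.toList)
    (p : (mosaicModel A e e.hd.toList.length T₀ t₀ h₀).Dom) :
    p ∈ C.ext (mosaicModel A e e.hd.toList.length T₀ t₀ h₀) ↔ C.encode ∈ p.1.2.toList := by
  have hw := he.ctx
  have hloc : ∀ p : (mosaicModel A e e.hd.toList.length T₀ t₀ h₀).Dom, locOK e.tl.tl p.1.2 :=
    fun p => (he.types _ (he.mem_of_mos _ (mem_of_survives p.2.1) _ p.2.2)).2
  induction C generalizing p with
  | top => simpa [Concept.ext] using ((hloc p).1 _ hC).1 rfl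
  | atom m => rfl
  | neg C ih =>
    have := ih (hw.tl_mem _ hC) p
    rw [((hloc p).1 _ hC).2.1 rfl]
    exact not_congr this
  | inf C D ihC ihD =>
    have h1 := ihC (hw.hd_mem _ (hw.tl_mem _ hC)) p
    have h2 := ihD (hw.tl_mem _ (hw.tl_mem _ hC)) p
    rw [((hloc p).1 _ hC).2.2 rfl]
    exact and_congr h1 h2
  | ex m C ih =>
    have hC' : C.encode ∈ e.tl.tl.tl.hd.toList := hw.tl_mem _ (hw.tl_mem _ hC)
    have hm : encName m ∈ e.tl.tl.tl.hd.toList := hw.hd_mem _ (hw.tl_mem _ hC)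
    constructor
    · rintro ⟨q, ⟨r, hr, hrm, hs, -⟩, hq⟩
      exact hs _ hC rfl hrm ((ih hC' q).1 hq)
    · intro h
      -- By stability the mosaic survives one more round, so its witness mosaic has survived as long
      -- as all others and lies in this model.
      obtain ⟨T', h1, ⟨u, hu, hxu, hsucc⟩, h2⟩ := (survives_stable p.2.1).2.2 _ p.2.2 _ h rfl
      refine ⟨⟨(T', u), h1, hu⟩, ⟨encName m, hm, rsub_refl _, hsucc, h2⟩, ?_⟩
      exact (ih hC' ⟨(T', u), h1, hu⟩).2 hxu

theorem IsFullContext.isModel_mosaicModel (he : IsFullContext e) {O : Ontology} {C D : Concept}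
    (ha : e.tl.tl.tl.tl = encInput O C D) :
    (mosaicModel A e e.hd.toList.length T₀ t₀ h₀).IsModel O := by
  have hw := he.ctx
  intro α hα
  have hmem : α.encode ∈ e.tl.tl.tl.tl.hd.toList := by
    rw [ha]; simpa [encInput] using ⟨α, hα, rfl⟩
  have hcl := hw.mem_of_mem_toList (hw.hd_mem _ hw.input_mem) hmem
  cases α with
  | concept C' D' =>
    intro p hp
    have hloc := (he.types _ (he.mem_of_mos _ (mem_of_survives p.2.1) _ p.2.2)).2
    rw [he.mem_ext_mosaicModel _ (hw.hd_mem _ (hw.tl_mem _ hcl))] at hp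
    rw [he.mem_ext_mosaicModel _ (hw.tl_mem _ (hw.tl_mem _ hcl))]
    exact hloc.2 _ hmem rfl hp
  | role m n =>
    rintro p ⟨r, hr, hrm, h⟩
    refine ⟨r, hr, rsub_trans hrm fun U _ hm hi => ?_, h⟩
    exact hi _ hmem rfl hm

/-- Elements of the same mosaic satisfy the same concepts over the signature. -/
theorem mem_ext_mosaicModel_of_fst_eq {S : Signature}
    (he : IsFullContext e) {h₀ : survives S.oracle e e.hd.toList.length T₀ ∧ t₀ ∈ T₀.toList}
    (E : Concept) (hE : E.Over S) (p q : (mosaicModel S.oracle e e.hd.toList.length T₀ t₀ h₀).Dom)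
    (hpq : p.1.1 = q.1.1) (hp : p ∈ E.ext (mosaicModel S.oracle e e.hd.toList.length T₀ t₀ h₀)) :
    q ∈ E.ext (mosaicModel S.oracle e e.hd.toList.length T₀ t₀ h₀) := by
  have hw := he.ctx
  induction E generalizing p q with
  | top => trivial
  | atom m =>
    have hcl : (Concept.atom m).encode ∈ e.tl.tl.tl.hd.toList :=
      hw.mem_of_sub _ (he.types _ (he.mem_of_mos _ (mem_of_survives p.2.1) _ p.2.2)).1 _ hp
    refine (survives_stable p.2.1).2.1 _ (mem_sigAtoms.2 ⟨hcl, rfl, Or.inl ⟨m, hE, rfl⟩⟩) _ p.2.2 _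
      ?_ hp
    rw [hpq]; exact q.2.2
  | neg C ih => exact fun h => hp (ih hE q p hpq.symm h)
  | inf C D ihC ihD => exact ⟨ihC hE.1 p q hpq hp.1, ihD hE.2 p q hpq hp.2⟩
  | ex m C ih =>
    obtain ⟨p', ⟨r, hr, hrm, hs, hl⟩, hp'⟩ := hp
    have hmem := hw.mem_of_rsub hr hrm
    have hsig : encName m ∈ (sigRoles S.oracle e.tl.tl).toList :=
      mem_sigRoles.2 ⟨hmem, Or.inr ⟨m, hE.1, rfl⟩⟩
    -- The link provides a successor for `q` inside the mosaic of `p'`, where the induction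
    -- hypothesis applies. The new edge is justified by `m` itself, since links pass from `r` to the
    -- roles above it.
    obtain ⟨u, hu, hsu⟩ := hl q.1.2 (by rw [hpq]; exact q.2.2) _ hsig hrm
    refine ⟨⟨(p'.1.1, u), p'.2.1, hu⟩, ⟨encName m, hmem, rsub_refl _, hsu, ?_⟩,
      ih hE.2 p' _ rfl hp'⟩
    intro v hv s hs' hms
    exact hl v (by rw [hpq]; exact hv) s hs' (rsub_trans hrm hms)

end

/-- If there is an interpolant, then being possible for a type with `C` is one. -/
theorem IsFullContext.theta_interpolates {e : Data} (he : IsFullContext e) {O : Ontology}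
    {C D : Concept} {S : Signature} (ha : e.tl.tl.tl.tl = encInput O C D)
    (hE : ∃ E, IsInterpolant O S C D E) {I : Interpretation} (hI : I.IsModel O) (d : I.Dom) :
    (d ∈ C.ext I → ∃ t ∈ e.tl.hd.toList, C.encode ∈ t.toList ∧
      theta S.oracle e I e.hd.toList.length t d) ∧
    ((∃ t ∈ e.tl.hd.toList, C.encode ∈ t.toList ∧
      theta S.oracle e I e.hd.toList.length t d) → d ∈ D.ext I) := by
  have hw := he.ctx
  have hC : C.encode ∈ e.tl.tl.tl.hd.toList := by
    have := hw.hd_mem _ (hw.tl_mem _ hw.input_mem)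
    rwa [ha] at this
  have hD : D.encode ∈ e.tl.tl.tl.hd.toList := by
    have := hw.tl_mem _ (hw.tl_mem _ hw.input_mem)
    rwa [ha] at this
  obtain ⟨u, hu⟩ := hw.exists_represents (I := I) d
  have hut := he.mem_types ha hI hu
  have huθ := he.theta_of_represents (A := S.oracle) ha hI e.hd.toList.length hu
  constructor
  · intro hd
    exact ⟨u, hut, (hu.2 _).2 ⟨hC, (holds_encode C).2 hd⟩, huθ⟩
  · rintro ⟨t, ht, hCt, htθ⟩
    by_contra hd
    -- The mosaic `T` of `d` contains both `t` and the true type `u`, and no interpolant separates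
    -- `(T, t)` from `(T, u)`.
    obtain ⟨T, hT, hT'⟩ := he.exists_mos fun u => theta S.oracle e I e.hd.toList.length u d
    have hsurv : survives S.oracle e e.hd.toList.length T :=
      he.survives_of_exactly _ hT fun u hu => by rw [hT']; exact and_iff_right hu
    have htT := (hT' t).2 ⟨ht, htθ⟩
    have huT := (hT' u).2 ⟨hut, huθ⟩
    obtain ⟨E, hEo, hE1, hE2⟩ := hE
    have hM := he.isModel_mosaicModel (h₀ := ⟨hsurv, htT⟩) ha
    have h1 := hE1 _ hM ((he.mem_ext_mosaicModel C hC ⟨(T, t), hsurv, htT⟩).2 hCt)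
    have h2 := mem_ext_mosaicModel_of_fst_eq he E hEo ⟨(T, t), hsurv, htT⟩ ⟨(T, u), hsurv, huT⟩ rfl h1
    have h3 := (he.mem_ext_mosaicModel D hD _).1 (hE2 _ hM h2)
    exact hd ((holds_encode D).1 ((hu.2 _).1 h3).2)

/-! ### Terms over the signature -/

/-- Terms over the names that the oracle accepts, with placeholders from `mac`. -/
inductive IsTerm (A : Set Data) (mac : Data → Prop) : Data → Prop
  | top : IsTerm A mac .tTop
  | atom {p : Data} : .cons (encUnary 0) p ∈ A → IsTerm A mac (.cons (encUnary 1) p)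
  | neg {x : Data} : IsTerm A mac x → IsTerm A mac x.tNeg
  | inf {x y : Data} : IsTerm A mac x → IsTerm A mac y → IsTerm A mac (x.tInf y)
  | ex {r x : Data} : .cons (encUnary 1) r ∈ A → IsTerm A mac x → IsTerm A mac (r.tEx x)
  | mac {p : Data} : mac p → IsTerm A mac (.cons (encUnary 5) p)

section
variable {A : Set Data} {mac : Data → Prop}

theorem IsTerm.mono {mac' : Data → Prop} (h : ∀ p, mac p → mac' p) {x : Data}
    (hx : IsTerm A mac x) : IsTerm A mac' x := by
  induction hx with
  | top => exact .top
  | atom h => exact .atom h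
  | neg _ ih => exact .neg ih
  | inf _ _ ih ih' => exact .inf ih ih'
  | ex h _ ih => exact .ex h ih
  | mac hp => exact .mac (h _ hp)

theorem IsTerm.of_mem_kidsTerm {x : Data} (hx : IsTerm A mac x) :
    ∀ y ∈ (kidsTerm x).toList, IsTerm A mac y := by
  cases hx with
  | top => simp [kidsTerm, Data.tTop]
  | atom => simp [kidsTerm]
  | neg h => simpa [kidsTerm, Data.tNeg] using h
  | inf h h' => simpa [kidsTerm, Data.tInf] using ⟨h, h'⟩
  | ex h h' => simpa [kidsTerm, Data.tEx] using h'
  | mac => simp [kidsTerm]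

theorem IsTerm.conj {a : Data} (h : ∀ x ∈ a.toList, IsTerm A mac x) : IsTerm A mac a.conj := by
  rw [Data.conj]
  generalize a.toList = l at h
  induction l with
  | nil => exact .top
  | cons x l ih => exact .inf (h x (by simp)) (ih fun y hy => h y (by simp [hy]))

end

/-! ### Extensions of the term constructors -/

section
variable {I : Interpretation} {mac : Data → I.Dom → Prop} {x y : Data} {d : I.Dom}

@[simp] theorem holds_tNeg : holds I mac x.tNeg d ↔ ¬ holds I mac x d := holds_of_neg rfl

@[simp] theorem holds_tInf : holds I mac (x.tInf y) d ↔ holds I mac x d ∧ holds I mac y d :=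
  holds_of_inf rfl

@[simp] theorem holds_tEx :
    holds I mac (x.tEx y) d ↔ ∃ d', dRole I x d d' ∧ holds I mac y d' := holds_of_ex rfl

@[simp] theorem holds_tMac : holds I mac (x.tMac y) d ↔ mac (.cons x y) d := holds_of_mac rfl

@[simp] theorem holds_conj {a : Data} :
    holds I mac a.conj d ↔ ∀ x ∈ a.toList, holds I mac x d := by
  rw [Data.conj]
  induction a.toList with
  | nil => simp [holds_of_top (x := Data.tTop) rfl]
  | cons x l ih => simp [ih]

end

/-! ### The meaning of the terms of the algorithm -/

/-- The intended meaning of the placeholders. -/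
def thetaMac (A : Set Data) (e : Data) (I : Interpretation) (p : Data) (d : I.Dom) : Prop :=
  theta A e I p.hd.toList.length p.tl d

section
variable {A : Set Data} {e : Data} {I : Interpretation} {d : I.Dom}

@[simp] theorem length_toList_encUnary (n : ℕ) : (encUnary n).toList.length = n := by
  simp [encUnary]

theorem holds_chi {n : ℕ} {T : Data} :
    holds I (thetaMac A e I) (chi e (encUnary n) T) d ↔ Exactly e (theta A e I n) T d := by
  simp only [chi, holds_conj, Data.toList_map, List.forall_mem_map]
  refine forall₂_congr fun u _ => ?_
  split <;> simp [thetaMac, *]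

theorem holds_body {n : ℕ} {t : Data} :
    holds I (thetaMac A e I) (body A e (encUnary n) t) d ↔ theta A e I (n + 1) t d := by
  have h1 : ∀ x ∈ (sigAtoms A e.tl.tl).toList,
      (holds I (thetaMac A e I) (if x ∈ t.toList then x else x.tNeg) d ↔
        (x ∈ t.toList ↔ dConc I x.tl d)) := by
    intro x hx
    have := holds_of_atom (I := I) (mac := thetaMac A e I) (d := d) (mem_sigAtoms.1 hx).2.1
    split <;> simp [*]
  have h2 : ∀ x, holds I (thetaMac A e I) (bodyEx A e (encUnary n) t x) d ↔ ∃ T ∈ e.hd.toList,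
      (∃ u ∈ T.toList, x.tl.tl ∈ u.toList ∧ succ e.tl.tl x.tl.hd t u) ∧
      ∀ s ∈ (sigRoles A e.tl.tl).toList, rsub e.tl.tl x.tl.hd s →
        ∃ d', dRole I s d d' ∧ Exactly e (theta A e I n) T d' := by
    intro x
    simp only [bodyEx, holds_tNeg, holds_tEx, holds_conj, Data.toList_map, List.forall_mem_map,
      Data.toList_filter, List.mem_filter, decide_eq_true_eq, holds_chi, not_forall,
      exists_prop, and_imp]
    push Not
    rfl
  have h3 : ∀ s, holds I (thetaMac A e I) (bodyAll e (encUnary n) t s) d ↔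
      ∀ d', dRole I s d d' → ∀ T ∈ e.hd.toList,
        Exactly e (theta A e I n) T d' → ∃ u ∈ T.toList, succ e.tl.tl s t u := by
    intro s
    simp only [bodyAll, holds_tNeg, holds_tEx, holds_conj, Data.toList_map, List.forall_mem_map,
      Data.toList_filter, List.mem_filter, decide_eq_true_eq, holds_chi]
    push Not
    refine forall₂_congr fun d' _ => forall_congr' fun T => ?_
    refine ⟨fun h hT hE => ?_, fun h hT hE => ?_⟩
    · by_contra! hc
      exact h ⟨hT, hc⟩ hE
    · obtain ⟨u, hu, hs⟩ := h hT.1 hE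
      exact hT.2 u hu hs
  simp only [body, holds_conj, Data.toList_append, Data.toList_map, Data.toList_filter,
    List.forall_mem_append, List.forall_mem_map, h2, h3, List.mem_filter, decide_eq_true_eq,
    and_imp]
  exact and_congr (forall₂_congr h1) Iff.rfl

theorem holds_goalTerm : holds I (thetaMac A e I) (goalTerm e) d ↔
    ∃ t ∈ e.tl.hd.toList, e.tl.tl.tl.tl.tl.hd ∈ t.toList ∧
      theta A e I e.hd.toList.length t d := by
  simp [goalTerm, thetaMac, Data.len, and_assoc]

/-- The placeholders of depth `n`. -/
def IsMac (e : Data) (n : ℕ) (p : Data) : Prop := ∃ t ∈ e.tl.hd.toList, p = .cons (encUnary n) t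

theorem isTerm_chi {n : ℕ} {T : Data} : IsTerm A (IsMac e n) (chi e (encUnary n) T) := by
  refine .conj fun x hx => ?_
  simp only [Data.toList_map, List.mem_map] at hx
  obtain ⟨u, hu, rfl⟩ := hx
  have : IsTerm A (IsMac e n) ((encUnary n).tMac u) := .mac ⟨u, hu, rfl⟩
  split
  · exact this
  · exact .neg this

theorem isTerm_body {n : ℕ} {t : Data} : IsTerm A (IsMac e n) (body A e (encUnary n) t) := by
  refine .conj fun x hx => ?_
  simp only [Data.toList_append, Data.toList_map, Data.toList_filter, List.mem_append,
    List.mem_map] at hx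
  rcases hx with ⟨x, hx, rfl⟩ | ⟨x, -, rfl⟩ | ⟨s, hs, rfl⟩
  · obtain ⟨-, h1, h2⟩ := mem_sigAtoms.1 hx
    have : IsTerm A (IsMac e n) x := by
      cases x with
      | nil => exact absurd (congrArg Data.size h1) (by simp [size_encUnary, Data.size])
      | cons a b =>
        simp only [Data.hd_cons, Data.tl_cons] at h1 h2
        exact h1 ▸ .atom h2
    split
    · exact this
    · exact .neg this
  · refine .neg (.conj fun y hy => ?_)
    simp only [Data.toList_map, List.mem_map] at hy
    obtain ⟨T, -, rfl⟩ := hy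
    refine .neg (.conj fun z hz => ?_)
    simp only [Data.toList_map, Data.toList_filter, List.mem_map, List.mem_filter] at hz
    obtain ⟨s, ⟨hs, -⟩, rfl⟩ := hz
    exact .ex (mem_sigRoles.1 hs).2 isTerm_chi
  · refine .neg (.ex (mem_sigRoles.1 hs).2 (.neg (.conj fun y hy => ?_)))
    simp only [Data.toList_map, List.mem_map] at hy
    obtain ⟨T, -, rfl⟩ := hy
    exact .neg isTerm_chi

theorem isTerm_goalTerm : IsTerm A (IsMac e e.hd.toList.length) (goalTerm e) := by
  refine .neg (.conj fun y hy => ?_)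
  simp only [Data.toList_map, Data.toList_filter, List.mem_map, List.mem_filter] at hy
  obtain ⟨t, ⟨ht, -⟩, rfl⟩ := hy
  exact .neg (.mac ⟨t, ht, rfl⟩)

end

/-! ### Topologically ordered lists -/

/-- The members of the list occur only after everything that they point to. -/
inductive Topo (ptr : Data → List Data) : List Data → Prop
  | nil : Topo ptr []
  | snoc {l : List Data} {x : Data} : Topo ptr l → (x ∈ l ∨ ∀ y ∈ ptr x, y ∈ l) →
      Topo ptr (l ++ [x])

section
variable {ptr : Data → List Data}

theorem Topo.mem_of_mem {l : List Data} (h : Topo ptr l) : ∀ x ∈ l, ∀ y ∈ ptr x, y ∈ l := by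
  induction h with
  | nil => simp
  | @snoc l x _ hx ih =>
    intro z hz y hy
    rw [List.mem_append, List.mem_singleton] at hz
    refine List.mem_append_left _ ?_
    rcases hz with hz | rfl
    · exact ih z hz y hy
    · exact hx.elim (fun h => ih _ h y hy) fun h => h y hy

/-- Pointers go to first occurrences, so repetitions do no harm: what a repeated member points to is
already present. -/
theorem Topo.idxOf_lt {l : List Data} (h : Topo ptr l) :
    ∀ (i : ℕ) (x : Data), l[i]? = some x → ∀ y ∈ ptr x, l.idxOf y < i := by
  induction h with
  | nil => simp
  | @snoc l x hl hx ih =>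
    intro i z hi y hy
    rcases lt_or_ge i l.length with hlt | hge
    · rw [List.getElem?_append_left hlt] at hi
      have hz := List.mem_of_getElem? hi
      rw [List.idxOf_append_of_mem (hl.mem_of_mem z hz y hy)]
      exact ih i z hi y hy
    · rw [List.getElem?_append_right hge] at hi
      obtain ⟨rfl⟩ : x = z := by
        have := List.mem_of_getElem? hi
        simpa [eq_comm] using this
      have hyl : y ∈ l := hx.elim (fun h => hl.mem_of_mem _ h y hy) fun h => h y hy
      rw [List.idxOf_append_of_mem hyl]
      exact (List.idxOf_lt_length_of_mem hyl).trans_le hge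

theorem Topo.append_kidsFirst {kids : Data → Data} {P : List Data} (hP : Topo ptr P)
    {l : List Data} (hl : KidsFirst kids l)
    (h : ∀ x ∈ l, x ∈ P ∨ ∀ y ∈ ptr x, y ∈ (kids x).toList) : Topo ptr (P ++ l) := by
  induction l using List.reverseRecOn with
  | nil => simpa using hP
  | append_singleton l x ih =>
    rw [← List.append_assoc]
    refine .snoc (ih ?_ fun y hy => h y (by simp [hy])) ?_
    · intro P' y R h' z hz
      exact hl P' y (R ++ [x]) (by simp [h']) z hz
    · rcases h x (by simp) with h | h
      · exact Or.inl (by simp [h])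
      · exact Or.inr fun y hy => List.mem_append_right _ (hl l x [] rfl y (h y hy))

theorem Topo.append_flatMap {f : Data → List Data} {P l : List Data} (hP : Topo ptr P)
    (h : ∀ t ∈ l, ∀ P', P ⊆ P' → Topo ptr P' → Topo ptr (P' ++ f t)) :
    Topo ptr (P ++ l.flatMap f) := by
  induction l generalizing P with
  | nil => simpa using hP
  | cons t l ih =>
    rw [List.flatMap_cons, ← List.append_assoc]
    refine ih (h t (by simp) P (fun _ => id) hP) fun u hu P' hPP' => h u (by simp [hu]) P' ?_
    exact fun x hx => hPP' (by simp [hx])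

end

/-! ### The DAG -/

/-- The terms that a term points to. -/
noncomputable def ptrs (A : Set Data) (e x : Data) : List Data :=
  if x.hd = encUnary 5 then
    if x.tl.hd = .nil then [] else [body A e x.tl.hd.tl x.tl.tl]
  else (kidsTerm x).toList

/-- All placeholders. -/
def IsAnyMac (e p : Data) : Prop := ∃ n ≤ e.hd.toList.length, IsMac e n p

@[simp] theorem encUnary_succ_tl (n : ℕ) : (encUnary (n + 1)).tl = encUnary n := rfl

theorem encUnary_succ_ne_nil (n : ℕ) : encUnary (n + 1) ≠ .nil := by
  simp [encUnary, List.replicate_succ, encList]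

@[simp] theorem encUnary_zero : encUnary 0 = .nil := rfl

section
variable {A : Set Data} {e : Data}

/-- The search does not descend into placeholders, whose pointers lead to bodies instead of kids, so
these must occur in `P` beforehand. -/
theorem Topo.append_dfs {P : List Data} (hP : Topo (ptrs A e) P) {n : ℕ} {x : Data}
    (hx : IsTerm A (IsMac e n) x) (hmac : ∀ t ∈ e.tl.hd.toList, (encUnary n).tMac t ∈ P) :
    Topo (ptrs A e) (P ++ (dfs kidsTerm x).toList) := by
  obtain ⟨-, h1, h2⟩ := dfs_spec kidsTerm total_kidsTerm_lt x
  refine hP.append_kidsFirst h1 fun y hy => ?_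
  have hy' := h2 (IsTerm A (IsMac e n)) (fun _ hz => hz.of_mem_kidsTerm) hx y hy
  by_cases h5 : y.hd = encUnary 5
  · left
    cases hy' with
    | mac h =>
      obtain ⟨t, ht, rfl⟩ := h
      exact hmac t ht
    | _ => simp [Data.tTop, Data.tNeg, Data.tInf, Data.tEx, -encUnary_zero] at h5
  · right
    simp [ptrs, h5]

theorem mem_levelKeys {n : ℕ} {t : Data} (ht : t ∈ e.tl.hd.toList) :
    (encUnary n).tMac t ∈ (levelKeys A e (encUnary n)).toList := by
  simp only [levelKeys, Data.toList_bind, List.mem_flatMap]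
  exact ⟨t, ht, by simp⟩

theorem topo_levels (m : ℕ) : Topo (ptrs A e)
    (((List.range m).map encUnary).flatMap fun k => (levelKeys A e k).toList) := by
  induction m with
  | zero => exact .nil
  | succ m ih =>
    rw [List.range_succ, List.map_append, List.flatMap_append]
    simp only [List.map_cons, List.map_nil, List.flatMap_singleton]
    rw [levelKeys, Data.toList_bind]
    refine ih.append_flatMap fun t ht P hP hTP => ?_
    cases m with
    | zero =>
      simp only [Data.toList_append, Data.toList_cons, Data.toList_nil, if_pos, encUnary_zero,
        List.nil_append]
      exact hTP.snoc (Or.inr (by simp [ptrs, Data.tMac]))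
    | succ n =>
      rw [if_neg (encUnary_succ_ne_nil n), Data.toList_append, ← List.append_assoc]
      refine .snoc (hTP.append_dfs isTerm_body fun u hu => hP ?_) (Or.inr ?_)
      · refine List.mem_flatMap.2 ⟨encUnary n, ?_, mem_levelKeys hu⟩
        exact List.mem_map.2 ⟨n, by simp, rfl⟩
      · have := (dfs_spec kidsTerm total_kidsTerm_lt (body A e (encUnary n) t)).1
        simp [ptrs, Data.tMac, encUnary_succ_ne_nil, this]

theorem topo_keys : Topo (ptrs A e) (keys A e).toList := by
  rw [keys, Data.toList_append, Data.toList_bind, Data.levels, toList_encList]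
  refine (topo_levels _).append_dfs isTerm_goalTerm fun t ht => ?_
  refine List.mem_flatMap.2 ⟨encUnary e.hd.toList.length, ?_, mem_levelKeys ht⟩
  exact List.mem_map.2 ⟨_, by simp, rfl⟩

theorem goalTerm_mem_keys : goalTerm e ∈ (keys A e).toList := by
  rw [keys, Data.toList_append]
  exact List.mem_append_right _ (dfs_spec kidsTerm total_kidsTerm_lt _).1

theorem isTerm_of_mem_keys {x : Data} (hx : x ∈ (keys A e).toList) : IsTerm A (IsAnyMac e) x := by
  have hdfs : ∀ {n : ℕ} {x y : Data}, n ≤ e.hd.toList.length → IsTerm A (IsMac e n) x →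
      y ∈ (dfs kidsTerm x).toList → IsTerm A (IsAnyMac e) y := by
    intro n x y hn hx hy
    refine (dfs_spec kidsTerm total_kidsTerm_lt x).2.2 (IsTerm A (IsAnyMac e))
      (fun _ hz => hz.of_mem_kidsTerm) (hx.mono fun p hp => ⟨n, hn, hp⟩) y hy
  rw [keys, Data.toList_append, List.mem_append, Data.toList_bind, List.mem_flatMap, Data.levels,
    toList_encList] at hx
  rcases hx with ⟨k, hk, hx⟩ | hx
  · obtain ⟨n, hn, rfl⟩ := List.mem_map.1 hk
    rw [List.mem_range] at hn
    rw [levelKeys, Data.toList_bind, List.mem_flatMap] at hx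
    obtain ⟨t, ht, hx⟩ := hx
    rw [Data.toList_append, List.mem_append] at hx
    rcases hx with hx | hx
    · cases n with
      | zero => simp at hx
      | succ n =>
        rw [if_neg (encUnary_succ_ne_nil n)] at hx
        exact hdfs (n := n) (by omega) isTerm_body hx
    · simp only [Data.toList_cons, Data.toList_nil, List.mem_singleton] at hx
      subst hx
      exact .mac ⟨n, by omega, t, ht, rfl⟩
  · exact hdfs le_rfl isTerm_goalTerm hx

end

theorem mem_oracle_concept {S : Signature} {p : Data} :
    .cons (encUnary 0) p ∈ S.oracle ↔ ∃ n ∈ S.conceptNames, p = encName n := by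
  simp [Signature.oracle, -encUnary_zero]

theorem mem_oracle_role {S : Signature} {p : Data} :
    .cons (encUnary 1) p ∈ S.oracle ↔ ∃ n ∈ S.roleNames, p = encName n := by
  simp [Signature.oracle, -encUnary_zero]

/-- The node of a term, where `K` lists all terms that become nodes. -/
noncomputable def nodeOf (S : Signature) (e K x : Data) : Node :=
  if x.hd = encUnary 1 then
    if h : ∃ n ∈ S.conceptNames, x.tl = encName n then .atom h.choose else .top
  else if x.hd = encUnary 2 then .neg (K.toList.idxOf x.tl)
  else if x.hd = encUnary 3 then .inf (K.toList.idxOf x.tl.hd) (K.toList.idxOf x.tl.tl)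
  else if x.hd = encUnary 4 then
    if h : ∃ n ∈ S.roleNames, x.tl.hd = encName n then .ex h.choose (K.toList.idxOf x.tl.tl)
    else .top
  else if x.hd = encUnary 5 then
    if x.tl.hd = .nil then .top
    else .inf (K.toList.idxOf (body S.oracle e x.tl.hd.tl x.tl.tl))
      (K.toList.idxOf (body S.oracle e x.tl.hd.tl x.tl.tl))
  else .top

section
variable {S : Signature} {e : Data}

theorem encode_nodeOf (K x : Data) : (nodeOf S e K x).encode = nodeData S.oracle e K x := by
  unfold nodeOf nodeData
  simp only [mem_oracle_concept, mem_oracle_role]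
  split_ifs with h1 h2 h3 h4 h5 h6 h7 h8
  · rw [Node.encode, ← h2.choose_spec.2, ← h1]
    cases x with
    | nil => exact absurd (congrArg Data.size h1) (by simp [size_encUnary, Data.size])
    | cons a b => rfl
  all_goals first | rfl | skip
  rw [Node.encode, ← h6.choose_spec.2]
  rfl

theorem children_nodeOf (K x : Data) : ∀ j ∈ (nodeOf S e K x).children,
    ∃ y ∈ ptrs S.oracle e x, j = K.toList.idxOf y := by
  unfold nodeOf ptrs kidsTerm
  split_ifs <;> simp_all [Node.children, -encUnary_zero]

/-- The DAG that the algorithm outputs. -/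
noncomputable def outputDAG (S : Signature) (e : Data) : DAG where
  nodes := (keys S.oracle e).toList.map (nodeOf S e (keys S.oracle e))
  root := (keys S.oracle e).toList.idxOf (goalTerm e)
  root_lt := by
    rw [List.length_map]
    exact List.idxOf_lt_length_of_mem goalTerm_mem_keys
  children_lt := by
    intro i v hv j hj
    rw [List.getElem?_map, Option.map_eq_some_iff] at hv
    obtain ⟨x, hx, rfl⟩ := hv
    obtain ⟨y, hy, rfl⟩ := children_nodeOf _ _ j hj
    exact topo_keys.idxOf_lt i x hx y hy

theorem encode_outputDAG : (outputDAG S e).encode = output S.oracle e := by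
  rw [DAG.encode, output, outputDAG, Data.idx, Data.map, List.map_map]
  congr 2
  exact List.map_congr_left fun x _ => encode_nodeOf _ x

/-- Every node unfolds to a concept over the signature that means what its term means. -/
theorem exists_unfolds (i : ℕ) : ∀ x ∈ (keys S.oracle e).toList,
    (keys S.oracle e).toList.idxOf x = i → ∃ C : Concept,
      Unfolds (outputDAG S e).nodes i C ∧ C.Over S ∧
      ∀ (I : Interpretation) (d : I.Dom),
        d ∈ C.ext I ↔ holds I (thetaMac S.oracle e I) x d := by
  induction i using Nat.strong_induction_on with
  | _ i ih =>
    rintro x hx rfl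
    have hget : (keys S.oracle e).toList[(keys S.oracle e).toList.idxOf x]? = some x := by
      rw [List.getElem?_eq_getElem (List.idxOf_lt_length_of_mem hx), List.getElem_idxOf]
    have hnode : (outputDAG S e).nodes[(keys S.oracle e).toList.idxOf x]? =
        some (nodeOf S e (keys S.oracle e) x) := by
      rw [outputDAG, List.getElem?_map, hget]; rfl
    -- Topological order makes all pointers lead to smaller positions, so the induction hypothesis
    -- covers them.
    have hptr : ∀ y ∈ ptrs S.oracle e x, ∃ C : Concept,
        Unfolds (outputDAG S e).nodes ((keys S.oracle e).toList.idxOf y) C ∧ C.Over S ∧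
        ∀ (I : Interpretation) (d : I.Dom),
          d ∈ C.ext I ↔ holds I (thetaMac S.oracle e I) y d := fun y hy =>
      ih _ (topo_keys.idxOf_lt _ _ hget y hy) y (topo_keys.mem_of_mem x hx y hy) rfl
    clear ih hget
    cases isTerm_of_mem_keys hx with
    | top =>
      refine ⟨.top, .top (hnode.trans ?_), trivial, fun I d => ?_⟩
      · simp [nodeOf, Data.tTop, -encUnary_zero]
      · simp [Concept.ext, holds_of_top (x := Data.tTop) rfl]
    | @atom p hp =>
      have h := mem_oracle_concept.1 hp
      have hv : nodeOf S e (keys S.oracle e) (.cons (encUnary 1) p) = .atom h.choose := by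
        rw [nodeOf, if_pos (Data.hd_cons _ _)]
        exact dif_pos h
      refine ⟨.atom h.choose, .atom (hnode.trans (by rw [hv])), h.choose_spec.1, fun I d => ?_⟩
      rw [holds_of_atom rfl, Data.tl_cons]
      conv_rhs => rw [h.choose_spec.2]
      rw [dConc_encName]; rfl
    | @neg y hy =>
      obtain ⟨C, h1, h2, h3⟩ := hptr y (by simp [ptrs, kidsTerm, Data.tNeg])
      refine ⟨.neg C, .neg (hnode.trans ?_) h1, h2, fun I d => ?_⟩
      · simp [nodeOf, Data.tNeg]
      · rw [holds_tNeg, ← h3]; rfl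
    | @inf y z hy hz =>
      obtain ⟨C, h1, h2, h3⟩ := hptr y (by simp [ptrs, kidsTerm, Data.tInf])
      obtain ⟨D, k1, k2, k3⟩ := hptr z (by simp [ptrs, kidsTerm, Data.tInf])
      refine ⟨.inf C D, .inf (hnode.trans ?_) h1 k1, ⟨h2, k2⟩, fun I d => ?_⟩
      · simp [nodeOf, Data.tInf]
      · rw [holds_tInf, ← h3, ← k3]; rfl
    | @ex r y hr hy =>
      obtain ⟨C, h1, h2, h3⟩ := hptr y (by simp [ptrs, kidsTerm, Data.tEx])
      have h := mem_oracle_role.1 hr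
      have hv : nodeOf S e (keys S.oracle e) (r.tEx y) =
          .ex h.choose ((keys S.oracle e).toList.idxOf y) := by
        rw [nodeOf, if_neg (by simp [Data.tEx]), if_neg (by simp [Data.tEx]),
          if_neg (by simp [Data.tEx]), if_pos (show (r.tEx y).hd = encUnary 4 from rfl)]
        exact dif_pos h
      refine ⟨.ex h.choose C, .ex (hnode.trans (by rw [hv])) h1, ⟨h.choose_spec.1, h2⟩,
        fun I d => ?_⟩
      rw [holds_tEx]
      refine exists_congr fun d' => and_congr ?_ (h3 I d')
      conv_rhs => rw [h.choose_spec.2]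
      rw [dRole_encName]
    | mac hp =>
      obtain ⟨n, -, t, ht, rfl⟩ := hp
      cases n with
      | zero =>
        refine ⟨.top, .top (hnode.trans ?_), trivial, fun I d => ?_⟩
        · simp [nodeOf]
        · rw [holds_of_mac rfl]
          simp [Concept.ext, thetaMac, theta]
      | succ n =>
        obtain ⟨C, h1, h2, h3⟩ := hptr (body S.oracle e (encUnary n) t)
          (by simp [ptrs, encUnary_succ_ne_nil])
        refine ⟨.inf C C, .inf (hnode.trans ?_) h1 h1, ⟨h2, h2⟩, fun I d => ?_⟩
        · simp [nodeOf, encUnary_succ_ne_nil]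
        · rw [holds_of_mac rfl, Concept.ext, Set.inter_self, h3, holds_body]
          simp [thetaMac]

theorem IsFullContext.exists_interpolant (he : IsFullContext e) {O : Ontology} {C D : Concept}
    (ha : e.tl.tl.tl.tl = encInput O C D) (hE : ∃ E, IsInterpolant O S C D E) :
    ∃ E, (outputDAG S e).Represents E ∧ IsInterpolant O S C D E := by
  obtain ⟨E, h1, h2, h3⟩ := exists_unfolds (S := S) _ _ (goalTerm_mem_keys (e := e)) rfl
  have h4 : ∀ (I : Interpretation) (d : I.Dom), d ∈ E.ext I ↔ ∃ t ∈ e.tl.hd.toList,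
      C.encode ∈ t.toList ∧ theta S.oracle e I e.hd.toList.length t d := by
    intro I d
    rw [h3, holds_goalTerm, ha]; rfl
  exact ⟨E, h1, h2, fun I hI d hd => (h4 I d).2 ((he.theta_interpolates ha hE hI d).1 hd),
    fun I hI d hd => (he.theta_interpolates ha hE hI d).2 ((h4 I d).1 hd)⟩

end

/-! ### Exponential time bounds -/

theorem polynomial_eval_le_pow (q : Polynomial ℕ) : ∃ c : ℕ, ∀ m, 2 ≤ m → q.eval m ≤ m ^ c := by
  induction q using Polynomial.induction_on' with
  | add p q hp hq =>
    obtain ⟨c, hc⟩ := hp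
    obtain ⟨d, hd⟩ := hq
    refine ⟨c + d + 1, fun m hm => ?_⟩
    have h1 := (hc m hm).trans (Nat.pow_le_pow_right (by omega) (Nat.le_add_right c d))
    have h2 := (hd m hm).trans (Nat.pow_le_pow_right (by omega) (Nat.le_add_left d c))
    have h3 := Nat.mul_le_mul_left (m ^ (c + d)) hm
    rw [Polynomial.eval_add, pow_succ]
    omega
  | monomial n a =>
    refine ⟨a + n, fun m hm => ?_⟩
    rw [Polynomial.eval_monomial, pow_add]
    exact Nat.mul_le_mul_right _ (Nat.lt_two_pow_self.le.trans (Nat.pow_le_pow_left hm a))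

theorem polynomial_eval_two_pow_le (q : Polynomial ℕ) :
    ∃ c : ℕ, ∀ k, q.eval (2 ^ k) ≤ 2 ^ (c * (k + 1)) := by
  obtain ⟨c, hc⟩ := polynomial_eval_le_pow q
  refine ⟨c, fun k => ?_⟩
  rw [mul_comm, pow_mul]
  -- Moving up to `2 ^ (k + 1)` ensures a base of at least `2`, also for `k = 0`.
  exact (polynomial_eval_mono q (Nat.pow_le_pow_right two_pos k.le_succ)).trans
    (hc _ (Nat.le_self_pow (by omega) 2))

/-- Functions computable in exponential time. -/
def ExpC (F : Set Data → Data → Data) : Prop :=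
  ∃ p : Polynomial ℕ, RunsIn F fun n => 2 ^ p.eval n

theorem two_pow_add_le (a b : ℕ) : 2 ^ a + b + 1 ≤ 2 ^ (a + b + 1) := by
  have h1 : b + 1 < 2 ^ (b + 1) := Nat.lt_two_pow_self
  have h2 : 1 ≤ 2 ^ a := Nat.one_le_two_pow
  rw [add_assoc a, pow_add]
  nlinarith

theorem ExpC.comp_pc {F H : Set Data → Data → Data} (hF : ExpC F) (hH : PC H) :
    ExpC fun A x => F A (H A x) := by
  obtain ⟨p, hp⟩ := hF
  obtain ⟨q, hq⟩ := hH
  refine ⟨p.comp q + q + 1, (hp.comp hq fun m n h => ?_).mono fun n => ?_⟩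
  · exact Nat.pow_le_pow_right two_pos (polynomial_eval_mono p h)
  · simpa [Polynomial.eval_comp] using two_pow_add_le (p.eval (q.eval n)) (q.eval n)

theorem PC.comp_expC {H F : Set Data → Data → Data} (hH : PC H) (hF : ExpC F) :
    ExpC fun A x => H A (F A x) := by
  obtain ⟨p, hp⟩ := hF
  obtain ⟨q, hq⟩ := hH
  obtain ⟨c, hc⟩ := polynomial_eval_two_pow_le (q + .X + 1)
  refine ⟨.C c * (p + 1), (hq.comp hp fun m n h => polynomial_eval_mono q h).mono fun n => ?_⟩
  simpa using hc (p.eval n)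

/-- The double exponential enters here; composition with polynomial-time functions on either side
stays within a single exponential. -/
theorem ExpC.comp {H F : Set Data → Data → Data} (hH : ExpC H) (hF : ExpC F) :
    ∃ p : Polynomial ℕ, RunsIn (fun A x => H A (F A x)) fun n => 2 ^ 2 ^ p.eval n := by
  obtain ⟨p, hp⟩ := hF
  obtain ⟨q, hq⟩ := hH
  obtain ⟨c, hc⟩ := polynomial_eval_two_pow_le (q + .X + 1)
  refine ⟨.C c * (p + 1), (hq.comp hp fun m n h => ?_).mono fun n => ?_⟩
  · exact Nat.pow_le_pow_right two_pos (polynomial_eval_mono q h)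
  · refine (two_pow_add_le _ _).trans (Nat.pow_le_pow_right two_pos ?_)
    simpa using hc (p.eval n)

theorem ExpC.subs : ExpC fun _ x => .cons x.hd.subs x := by
  obtain ⟨q, hq⟩ := RunsIn.subs
  obtain ⟨c, hc⟩ := polynomial_eval_two_pow_le q
  refine ⟨.C c * (2 * .X + 4), hq.mono fun n => ?_⟩
  refine (polynomial_eval_mono q (?_ : _ ≤ 2 ^ (2 * n + 3))).trans ((hc _).trans_eq (by simp))
  have : 2 * n + 2 < 2 ^ (2 * n + 2) := Nat.lt_two_pow_self
  rw [pow_succ 2 (2 * n + 2)]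
  omega

/-! ### The size of the input -/

theorem size_encName_le (n : ℕ) : (encName n).size ≤ 4 * nameSize n := by
  have h := size_encList_le_mul (l := n.bits.map encBit) (m := 3) (by
    simp only [List.mem_map]
    rintro _ ⟨b, -, rfl⟩
    cases b <;> simp [encBit, Data.size])
  rw [List.length_map, Nat.size_eq_bits_len] at h
  unfold encName nameSize
  omega

theorem one_le_nameSize (n : ℕ) : 1 ≤ nameSize n := by unfold nameSize; omega

theorem Concept.size_encode_le (C : Concept) : C.encode.size ≤ 16 * C.size := by
  induction C with
  | top => simp [Concept.encode, Concept.size, Data.size]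
  | atom n =>
    have := size_encName_le n
    have := one_le_nameSize n
    simp only [Concept.encode, Concept.size, Data.size, size_encUnary]
    omega
  | neg C ih =>
    simp only [Concept.encode, Concept.size, Data.size, size_encUnary]
    omega
  | inf C D ihC ihD =>
    simp only [Concept.encode, Concept.size, Data.size, size_encUnary]
    omega
  | ex r C ih =>
    have := size_encName_le r
    simp only [Concept.encode, Concept.size, Data.size, size_encUnary]
    omega

/-- Strictness leaves one node for the list cell that holds the inclusion. -/
theorem Inclusion.size_encode_lt (α : Inclusion) : α.encode.size < 16 * α.size := by
  cases α with
  | concept C D =>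
    have := C.size_encode_le
    have := D.size_encode_le
    simp only [Inclusion.encode, Inclusion.size, Data.size, size_encUnary]
    omega
  | role r s =>
    have := size_encName_le r
    have := size_encName_le s
    simp only [Inclusion.encode, Inclusion.size, Data.size, size_encUnary]
    omega

theorem size_encInput_le (O : Ontology) (C D : Concept) :
    (encInput O C D).size ≤ 16 * (Ontology.size O + C.size + D.size) + 3 := by
  have h : (encList (O.map Inclusion.encode)).size ≤ 16 * Ontology.size O + 1 := by
    induction O with
    | nil => simp [encList, Data.size]
    | cons α O ih =>
      have := α.size_encode_lt
      simp only [Ontology.size, List.map_cons, List.sum_cons, encList, Data.size] at ih ⊢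
      omega
  have := C.size_encode_le
  have := D.size_encode_le
  simp only [encInput, Data.size]
  omega

/-! ### The whole algorithm -/

/-- The context of an input. -/
noncomputable def context (a : Data) : Data :=
  .cons (dfs kidsAll a).subs (.cons (dfs kidsAll a) a)

/-- The full context of a context. -/
noncomputable def fullContext (w : Data) : Data :=
  restrictMosaics (.cons (w.hd.filter (locOK w)).subs (.cons (w.hd.filter (locOK w)) w))

theorem ExpC.context : ExpC fun _ a => context a :=
  ExpC.subs.comp_pc ((PC.dfs total_kidsAll_lt PC.kidsAll PC.id).cons PC.id)

/-- Types are filtered from sets that the context already lists. Only the enumeration of their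
subsets is exponential in the context, and the output is polynomial in the result. -/
theorem ExpC.output : ExpC fun A w => output A (fullContext w) :=
  (PC.output.comp PC.restrictMosaics).comp_expC
    (ExpC.subs.comp_pc ((PC.filter PC.id.hd DP.locOK).cons PC.id))

end ALCH

/-- One program and one polynomial `p` work for all ontologies, concepts and signatures: whenever
an interpolant exists, the program outputs a DAG representation of one in time `2 ^ 2 ^ p(n)`,
where `n = |O| + |C₀| + |D₀|`. -/
theorem mainTheorem1 :
    ∃ (P : ALCH.Program) (p : Polynomial ℕ),
      ∀ (O : ALCH.Ontology) (C₀ D₀ : ALCH.Concept) (S : ALCH.Signature),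
        (∃ E : ALCH.Concept, ALCH.IsInterpolant O S C₀ D₀ E) →
          ∃ (G : ALCH.DAG) (E : ALCH.Concept) (t : ℕ),
            P.OutputsIn S.oracle (ALCH.encInput O C₀ D₀) G.encode t ∧
            t ≤ 2 ^ 2 ^ p.eval (ALCH.Ontology.size O + C₀.size + D₀.size) ∧
            G.Represents E ∧
            ALCH.IsInterpolant O S C₀ D₀ E := by
  obtain ⟨p, P, hP⟩ := ALCH.ExpC.output.comp ALCH.ExpC.context
  -- The inner polynomial bounds the size of the input tree by the number of symbols.
  refine ⟨P 0, p.comp (16 * .X + 3), fun O C D S hE => ?_⟩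
  obtain ⟨τ, t, h1, h2, -, h3, -⟩ := hP S.oracle 0 (ALCH.initStore (ALCH.encInput O C D))
  have h0 : ALCH.initStore (ALCH.encInput O C D) 0 = ALCH.encInput O C D := rfl
  rw [h0] at h2 h3
  obtain ⟨E, hE1, hE2⟩ :=
    (ALCH.IsContext.of_dfs (ALCH.encInput O C D)).fullContext.exists_interpolant rfl hE
  refine ⟨_, E, t, ⟨τ, h1, ?_⟩, h3.trans ?_, hE1, hE2⟩
  · rw [h2, ALCH.encode_outputDAG]; rfl
  · refine Nat.pow_le_pow_right two_pos (Nat.pow_le_pow_right two_pos ?_)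
    rw [Polynomial.eval_comp]
    refine ALCH.polynomial_eval_mono p ((ALCH.size_encInput_le O C D).trans_eq ?_)
    simp
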